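/- Let $n$ be a natural number and $\lambda_1,\dots,\lambda_n\in\mathbb R$ with $\lambda_i=\lambda_j$ for all $i,j$. Let $G=G(\lambda_1,\dots,\lambda_n)$ be the oscillator group, i.e. the connected, simply connected Lie group whose Lie algebra has a basis $e_1,\dots,e_n,e_{n+1},\dots,e_{2n},\xi,\zeta$ with the only non-vanishing brackets $$[e_i,e_{n+j}]=\delta_{ij}\,\xi,\qquad [\zeta,e_j]=\lambda_j e_{n+j},\qquad [\zeta,e_{n+j}]=-\lambda_j e_j\qquad(1\le i,j\le n),$$ endowed with the left-invariant Riemannian metric $g$ for which this basis is orthonormal. Let $T_1G=\{(p,v)\in TG: g_p(v,v)=1\}$ be the unit tangent bundle with the metric $g_S$ induced by the Sasaki metric $d\sigma^2=ds^2+|Dv|_g^2$ of $TG$, where $Dv$ is the covariant differential for the Levi-Civita connection of $g$. Let $V$ be a left-invariant unit vector field on $G$. If $V$ defines a harmonic map $V:(G,g)\to(T_1G,g_S)$ (its tension field vanishes), then $V$ is minimal, i.e. the submanifold $V(G)\subset(T_1G,g_S)$ has zero mean curvature vector. -/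

import Mathlib

open scoped ContDiff Manifold

noncomputable section

/-! ### Riemannian geometry in a global chart

A Riemannian manifold diffeomorphic to a finite-dimensional real vector space `E` is described by
the field `g : E → E →L[ℝ] E →L[ℝ] ℝ` of its scalar products; every tangent space is `E`, and the
tangent bundle is `E × E`, a point `(x, v)` being the vector `v` at the point `x`. -/

namespace Riem

variable {E F : Type*} [NormedAddCommGroup E] [NormedSpace ℝ E]
  [NormedAddCommGroup F] [NormedSpace ℝ F]

/-- A field of bilinear forms on `E` (a metric, when symmetric, positive definite and smooth). -/
abbrev MetricField (E : Type*) [NormedAddCommGroup E] [NormedSpace ℝ E] : Type _ :=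
  E → E →L[ℝ] E →L[ℝ] ℝ

/-- Christoffel symbols of the first kind; see `christoffelLower_apply`. -/
def christoffelLower (g : MetricField E) (x : E) : E →L[ℝ] E →L[ℝ] E →L[ℝ] ℝ :=
  (1 / 2 : ℝ) • (fderiv ℝ g x + (fderiv ℝ g x).flip +
    (-1 : ℝ) • ((ContinuousLinearMap.flipₗᵢ ℝ E E ℝ).toContinuousLinearEquiv :
      (E →L[ℝ] E →L[ℝ] ℝ) →L[ℝ] (E →L[ℝ] E →L[ℝ] ℝ)) ∘L (fderiv ℝ g x).flip)

theorem christoffelLower_apply (g : MetricField E) (x X Y Z : E) :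
    christoffelLower g x X Y Z =
      1 / 2 * (fderiv ℝ g x X Y Z + fderiv ℝ g x Y X Z - fderiv ℝ g x Z X Y) := by
  change (1 / 2 : ℝ) * (fderiv ℝ g x X Y Z + fderiv ℝ g x Y X Z + (-1) * fderiv ℝ g x Z X Y) = _
  ring

/-- Christoffel symbols of the second kind `Γ(X, Y)`: the Levi-Civita connection of `g` is
`∇_X Y = D_X Y + Γ(X, Y)`.  (`inverse` raises the index: it is the inverse of the isomorphism
`E → E*` given by the metric.) -/
def christoffel (g : MetricField E) (x : E) : E →L[ℝ] E →L[ℝ] E :=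
  (ContinuousLinearMap.compL ℝ E (E →L[ℝ] ℝ) E (g x).inverse) ∘L christoffelLower g x

theorem christoffel_apply (g : MetricField E) (x X Y : E) :
    christoffel g x X Y = (g x).inverse (christoffelLower g x X Y) := rfl

/-- The trace of a bilinear map `B` with respect to the scalar product `G`, that is
`∑ B(b_i, ♯b^i) = ∑ G^{ij} B(b_i, b_j)` for a basis `b` with dual basis `b^i`. -/
def metricTrace [FiniteDimensional ℝ E] {W : Type*} [AddCommMonoid W]
    (G : E →L[ℝ] E →L[ℝ] ℝ) (B : E → E → W) : W :=
  ∑ i, B (Module.finBasis ℝ E i)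
    (G.inverse (LinearMap.toContinuousLinearMap ((Module.finBasis ℝ E).coord i)))

/-- The covariant derivative, for the Levi-Civita connection of the metric `h` on the target, of
the field `f_* Y` along the map `f` in the direction `X`, where `Y` is constant in the chart. -/
def covDeriv (h : MetricField F) (f : E → F) (x X Y : E) : F :=
  fderiv ℝ (fderiv ℝ f) x X Y + christoffel h (f x) (fderiv ℝ f x X) (fderiv ℝ f x Y)

/-- The second fundamental form `(∇ df)(X, Y)` of a map `f : (E, g) → (F, h)`. -/
def mapHessian (g : MetricField E) (h : MetricField F) (f : E → F) (x X Y : E) : F :=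
  covDeriv h f x X Y - fderiv ℝ f x (christoffel g x X Y)

/-- The tension field `trace_g (∇ df)` of a map `f : (E, g) → (F, h)`. -/
def tension [FiniteDimensional ℝ E] (g : MetricField E) (h : MetricField F) (f : E → F)
    (x : E) : F :=
  metricTrace (g x) (mapHessian g h f x)

/-- The pull-back `f^* h` of a metric. -/
def pullback (h : MetricField F) (f : E → F) : MetricField E := fun x =>
  (h (f x)).bilinearComp (fderiv ℝ f x) (fderiv ℝ f x)

/-- The connection map `K(X, W) = W + Γ_x(X, v)` at the point `(x, v)` of the tangent bundle, i.e.
the covariant differential `DV`. -/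
def connectionMap (g : MetricField E) (p : E × E) : E × E →L[ℝ] E :=
  ContinuousLinearMap.snd ℝ E E +
    ((christoffel g p.1).flip p.2) ∘L ContinuousLinearMap.fst ℝ E E

/-- The Sasaki metric `dσ² = ds² + |DV|²` on the tangent bundle `E × E` of `(E, g)`. -/
def sasaki (g : MetricField E) : MetricField (E × E) := fun p =>
  (g p.1).bilinearComp (ContinuousLinearMap.fst ℝ E E) (ContinuousLinearMap.fst ℝ E E) +
    (g p.1).bilinearComp (connectionMap g p) (connectionMap g p)

/-- The unit tangent bundle `T₁M`. -/
def unitTangentBundle (g : MetricField E) : Set (E × E) := {p | g p.1 p.2 p.2 = 1}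

/-- The tangent space at `p` of the unit tangent bundle, a regular level set of
`(x, v) ↦ g_x(v, v)`. -/
def tangentUnit (g : MetricField E) (p : E × E) : Submodule ℝ (E × E) :=
  LinearMap.ker (fderiv ℝ (fun q : E × E => g q.1 q.2 q.2) p).toLinearMap

/-- The map from `M` to its tangent bundle that a vector field defines. -/
def graphMap (V : E → E) : E → E × E := fun x => (x, V x)

/-- `V` is a unit vector field: it takes its values in the unit tangent bundle. -/
def IsUnitField (g : MetricField E) (V : E → E) : Prop :=
  ∀ x, graphMap V x ∈ unitTangentBundle g

/-- The unit vector field `V` defines a harmonic map `(M, g) → (T₁M, g_S)`: the tension field of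
this map vanishes.  As `T₁M` is a Riemannian submanifold of `(TM, g_S)`, that tension field is the
component tangent to `T₁M` of the tension field of `V : (M, g) → (TM, g_S)`. -/
def DefinesHarmonicMap [FiniteDimensional ℝ E] (g : MetricField E) (V : E → E) : Prop :=
  IsUnitField g V ∧ ∀ x, ∀ W ∈ tangentUnit g (graphMap V x),
    sasaki g (graphMap V x) (tension g (sasaki g) (graphMap V) x) W = 0

/-- `W` is normal to the submanifold `V(M)` of `(T₁M, g_S)` at the point `V(x)`. -/
def IsNormalAt (g : MetricField E) (V : E → E) (x : E) (W : E × E) : Prop :=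
  W ∈ tangentUnit g (graphMap V x) ∧
    ∀ X, sasaki g (graphMap V x) (fderiv ℝ (graphMap V) x X) W = 0

/-- The second fundamental form `Ω_W(V_* X, V_* Y)` of the submanifold `V(M)` of `(T₁M, g_S)` with
respect to a normal vector `W`. -/
def secondFundamentalForm (g : MetricField E) (V : E → E) (x : E) (W : E × E) (X Y : E) : ℝ :=
  sasaki g (graphMap V x) (covDeriv (sasaki g) (graphMap V) x X Y) W

/-- The component `g_S(H, W)`, along a normal vector `W`, of the mean curvature vector `H` of the
submanifold `V(M)`, with its induced metric, in `(T₁M, g_S)`. -/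
def meanCurvature [FiniteDimensional ℝ E] (g : MetricField E) (V : E → E) (x : E)
    (W : E × E) : ℝ :=
  (Module.finrank ℝ E : ℝ)⁻¹ *
    metricTrace (pullback (sasaki g) (graphMap V) x) (secondFundamentalForm g V x W)

/-- The unit vector field `V` is minimal: the mean curvature vector of the submanifold `V(M)` of
`(T₁M, g_S)` vanishes. -/
def IsMinimalField [FiniteDimensional ℝ E] (g : MetricField E) (V : E → E) : Prop :=
  IsUnitField g V ∧ ∀ x, ∀ W, IsNormalAt g V x W → meanCurvature g V x W = 0

end Riem

/-! ### The oscillator group -/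

/-- The oscillator group `G(λ₁, …, λₙ)`, realized on `ℝ^{2n+2}`: the semidirect product of the
Heisenberg group, with coordinates `(x, y, s)`, and `ℝ`, with coordinate `t`, which acts on the
`j`-th plane `(x_j, y_j)` by the rotation with the angle `λ_j t`. -/
def OscillatorGroup (n : ℕ) (_lam : Fin n → ℝ) : Type :=
  EuclideanSpace ℝ ((Fin n ⊕ Fin n) ⊕ Fin 2)

namespace OscillatorGroup

variable {n : ℕ} {lam : Fin n → ℝ}

instance : NormedAddCommGroup (OscillatorGroup n lam) :=
  inferInstanceAs (NormedAddCommGroup (EuclideanSpace ℝ ((Fin n ⊕ Fin n) ⊕ Fin 2)))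

/-- The Euclidean scalar product, for which the basis `e_1, …, e_{2n}, ξ, ζ` of the Lie algebra
(the standard basis of `ℝ^{2n+2}`) is orthonormal. -/
instance : InnerProductSpace ℝ (OscillatorGroup n lam) :=
  inferInstanceAs (InnerProductSpace ℝ (EuclideanSpace ℝ ((Fin n ⊕ Fin n) ⊕ Fin 2)))

instance : FiniteDimensional ℝ (OscillatorGroup n lam) :=
  inferInstanceAs (FiniteDimensional ℝ (EuclideanSpace ℝ ((Fin n ⊕ Fin n) ⊕ Fin 2)))

/-- The point with given coordinates. -/
def mk (x y : Fin n → ℝ) (s t : ℝ) : OscillatorGroup n lam :=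
  WithLp.toLp 2 (Sum.elim (Sum.elim x y) ![s, t])

/-- The coordinate along `e_j`. -/
def x (p : OscillatorGroup n lam) (j : Fin n) : ℝ := WithLp.ofLp p (Sum.inl (Sum.inl j))

/-- The coordinate along `e_{n+j}`. -/
def y (p : OscillatorGroup n lam) (j : Fin n) : ℝ := WithLp.ofLp p (Sum.inl (Sum.inr j))

/-- The coordinate along `ξ`. -/
def s (p : OscillatorGroup n lam) : ℝ := WithLp.ofLp p (Sum.inr 0)

/-- The coordinate along `ζ`. -/
def t (p : OscillatorGroup n lam) : ℝ := WithLp.ofLp p (Sum.inr 1)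

/-- First coordinate of the `j`-th plane component of `q`, rotated by the angle `λ_j τ`. -/
def rotX (τ : ℝ) (q : OscillatorGroup n lam) (j : Fin n) : ℝ :=
  Real.cos (lam j * τ) * q.x j - Real.sin (lam j * τ) * q.y j

/-- Second coordinate of the `j`-th plane component of `q`, rotated by the angle `λ_j τ`. -/
def rotY (τ : ℝ) (q : OscillatorGroup n lam) (j : Fin n) : ℝ :=
  Real.sin (lam j * τ) * q.x j + Real.cos (lam j * τ) * q.y j

instance : Mul (OscillatorGroup n lam) where
  mul p q := mk (fun j => p.x j + rotX p.t q j) (fun j => p.y j + rotY p.t q j)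
    (p.s + q.s + 1 / 2 * ∑ j, (p.x j * rotY p.t q j - p.y j * rotX p.t q j)) (p.t + q.t)

instance : One (OscillatorGroup n lam) where
  one := mk 0 0 0 0

instance : Inv (OscillatorGroup n lam) where
  inv p := mk (fun j => -rotX (-p.t) p j) (fun j => -rotY (-p.t) p j) (-p.s) (-p.t)

@[ext]
theorem ext {p q : OscillatorGroup n lam} (hx : ∀ j, p.x j = q.x j) (hy : ∀ j, p.y j = q.y j)
    (hs : p.s = q.s) (ht : p.t = q.t) : p = q := by
  apply WithLp.ofLp_injective 2
  funext i
  rcases i with (j | j) | k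
  · exact hx j
  · exact hy j
  · fin_cases k
    · exact hs
    · exact ht

section coordinates

variable (a b : Fin n → ℝ) (c d : ℝ) (p q : OscillatorGroup n lam) (j : Fin n)

@[simp] theorem mk_x : (mk a b c d : OscillatorGroup n lam).x j = a j := rfl
@[simp] theorem mk_y : (mk a b c d : OscillatorGroup n lam).y j = b j := rfl
@[simp] theorem mk_s : (mk a b c d : OscillatorGroup n lam).s = c := rfl
@[simp] theorem mk_t : (mk a b c d : OscillatorGroup n lam).t = d := rfl
@[simp] theorem one_x : (1 : OscillatorGroup n lam).x j = 0 := rfl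
@[simp] theorem one_y : (1 : OscillatorGroup n lam).y j = 0 := rfl
@[simp] theorem one_s : (1 : OscillatorGroup n lam).s = 0 := rfl
@[simp] theorem one_t : (1 : OscillatorGroup n lam).t = 0 := rfl
@[simp] theorem mul_x : (p * q).x j = p.x j + rotX p.t q j := rfl
@[simp] theorem mul_y : (p * q).y j = p.y j + rotY p.t q j := rfl
@[simp] theorem mul_s : (p * q).s =
    p.s + q.s + 1 / 2 * ∑ j, (p.x j * rotY p.t q j - p.y j * rotX p.t q j) := rfl
@[simp] theorem mul_t : (p * q).t = p.t + q.t := rfl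
@[simp] theorem inv_x : p⁻¹.x j = -rotX (-p.t) p j := rfl
@[simp] theorem inv_y : p⁻¹.y j = -rotY (-p.t) p j := rfl
@[simp] theorem inv_s : p⁻¹.s = -p.s := rfl
@[simp] theorem inv_t : p⁻¹.t = -p.t := rfl

end coordinates

instance : Group (OscillatorGroup n lam) :=
  Group.ofLeftAxioms
    (fun p q r => by
      ext j
      · simp only [mul_x, mul_y, mul_t, rotX, rotY, mul_add, Real.cos_add, Real.sin_add]; ring
      · simp only [mul_x, mul_y, mul_t, rotX, rotY, mul_add, Real.cos_add, Real.sin_add]; ring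
      · simp only [mul_s, mul_x, mul_y, mul_t, rotX, rotY]
        have h : ∀ u v w S₁ S₂ S₃ S₄ : ℝ, S₁ + S₂ = S₃ + S₄ →
            (u + v + 1 / 2 * S₁ + w + 1 / 2 * S₂ = u + (v + w + 1 / 2 * S₃) + 1 / 2 * S₄) := by
          intro u v w S₁ S₂ S₃ S₄ h; linarith
        apply h
        rw [← Finset.sum_add_distrib, ← Finset.sum_add_distrib]
        refine Finset.sum_congr rfl fun j _ => ?_
        rw [mul_add (lam j), Real.cos_add, Real.sin_add]
        linear_combination
          (-(q.x j * (Real.sin (lam j * q.t) * r.x j + Real.cos (lam j * q.t) * r.y j)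
            - q.y j * (Real.cos (lam j * q.t) * r.x j - Real.sin (lam j * q.t) * r.y j))) * (-1) *
            Real.sin_sq_add_cos_sq (lam j * p.t)
      · simp only [mul_t]; ring)
    (fun p => by
      ext j <;> simp [rotX, rotY])
    (fun p => by
      ext j
      · simp
      · simp
      · simp only [mul_s, inv_s, inv_x, inv_y, inv_t, one_s]
        rw [Finset.sum_eq_zero (fun j _ => by ring)]
        ring
      · simp)

/-! The group is a Lie group, and its Lie algebra is the oscillator algebra. -/

theorem contDiff_coords {A : Type*} [NormedAddCommGroup A] [NormedSpace ℝ A]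
    {f : A → OscillatorGroup n lam} (hx : ∀ j, ContDiff ℝ ∞ fun a => (f a).x j)
    (hy : ∀ j, ContDiff ℝ ∞ fun a => (f a).y j) (hs : ContDiff ℝ ∞ fun a => (f a).s)
    (ht : ContDiff ℝ ∞ fun a => (f a).t) : ContDiff ℝ ∞ f := by
  refine contDiff_euclidean.2 fun i => ?_
  rcases i with (j | j) | k
  · exact hx j
  · exact hy j
  · fin_cases k
    · exact hs
    · exact ht

/-- The coordinates as continuous linear forms. -/
def coordL (i : (Fin n ⊕ Fin n) ⊕ Fin 2) : OscillatorGroup n lam →L[ℝ] ℝ :=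
  (EuclideanSpace.proj i : EuclideanSpace ℝ ((Fin n ⊕ Fin n) ⊕ Fin 2) →L[ℝ] ℝ)

theorem contDiff_x (j : Fin n) : ContDiff ℝ ∞ fun p : OscillatorGroup n lam => p.x j :=
  (coordL (Sum.inl (Sum.inl j))).contDiff

theorem contDiff_y (j : Fin n) : ContDiff ℝ ∞ fun p : OscillatorGroup n lam => p.y j :=
  (coordL (Sum.inl (Sum.inr j))).contDiff

theorem contDiff_s : ContDiff ℝ ∞ fun p : OscillatorGroup n lam => p.s :=
  (coordL (Sum.inr 0)).contDiff

theorem contDiff_t : ContDiff ℝ ∞ fun p : OscillatorGroup n lam => p.t :=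
  (coordL (Sum.inr 1)).contDiff

theorem contDiff_rotX (j : Fin n) :
    ContDiff ℝ ∞ fun a : ℝ × OscillatorGroup n lam => rotX a.1 a.2 j := by
  have hx := (contDiff_x (lam := lam) j).comp (contDiff_snd (𝕜 := ℝ) (E := ℝ))
  have hy := (contDiff_y (lam := lam) j).comp (contDiff_snd (𝕜 := ℝ) (E := ℝ))
  exact ((Real.contDiff_cos.comp (contDiff_const.mul contDiff_fst)).mul hx).sub
    ((Real.contDiff_sin.comp (contDiff_const.mul contDiff_fst)).mul hy)

theorem contDiff_rotY (j : Fin n) :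
    ContDiff ℝ ∞ fun a : ℝ × OscillatorGroup n lam => rotY a.1 a.2 j := by
  have hx := (contDiff_x (lam := lam) j).comp (contDiff_snd (𝕜 := ℝ) (E := ℝ))
  have hy := (contDiff_y (lam := lam) j).comp (contDiff_snd (𝕜 := ℝ) (E := ℝ))
  exact ((Real.contDiff_sin.comp (contDiff_const.mul contDiff_fst)).mul hx).add
    ((Real.contDiff_cos.comp (contDiff_const.mul contDiff_fst)).mul hy)

theorem contDiff_mul' :
    ContDiff ℝ ∞ fun a : OscillatorGroup n lam × OscillatorGroup n lam => a.1 * a.2 := by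
  have hX := fun j => (contDiff_rotX (lam := lam) j).comp
    ((contDiff_t.comp contDiff_fst).prodMk (contDiff_snd (𝕜 := ℝ) (E := OscillatorGroup n lam)))
  have hY := fun j => (contDiff_rotY (lam := lam) j).comp
    ((contDiff_t.comp contDiff_fst).prodMk (contDiff_snd (𝕜 := ℝ) (E := OscillatorGroup n lam)))
  have hx := fun j => (contDiff_x (lam := lam) j).comp
    (contDiff_fst (𝕜 := ℝ) (F := OscillatorGroup n lam))
  have hy := fun j => (contDiff_y (lam := lam) j).comp
    (contDiff_fst (𝕜 := ℝ) (F := OscillatorGroup n lam))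
  refine contDiff_coords (fun j => (hx j).add (hX j)) (fun j => (hy j).add (hY j)) ?_
    ((contDiff_t.comp contDiff_fst).add (contDiff_t.comp contDiff_snd))
  exact ((contDiff_s.comp contDiff_fst).add (contDiff_s.comp contDiff_snd)).add
    (contDiff_const.mul (ContDiff.sum fun j _ => ((hx j).mul (hY j)).sub ((hy j).mul (hX j))))

theorem contDiff_inv' : ContDiff ℝ ∞ fun p : OscillatorGroup n lam => p⁻¹ :=
  contDiff_coords
    (fun j => ((contDiff_rotX j).comp (contDiff_t.neg.prodMk contDiff_id)).neg)
    (fun j => ((contDiff_rotY j).comp (contDiff_t.neg.prodMk contDiff_id)).neg)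
    contDiff_s.neg contDiff_t.neg

instance : LieGroup 𝓘(ℝ, OscillatorGroup n lam) ∞ (OscillatorGroup n lam) where
  contMDiff_mul := by
    rw [← modelWithCornersSelf_prod, chartedSpaceSelf_prod]
    exact contDiff_mul'.contMDiff
  contMDiff_inv := contDiff_inv'.contMDiff

/-- The differential of a left translation, in coordinates. -/
theorem fderiv_mul_left (p q v : OscillatorGroup n lam) :
    fderiv ℝ (fun r => p * r) q v = mk (rotX p.t v) (rotY p.t v)
      (v.s + 1 / 2 * ∑ j, (p.x j * rotY p.t v j - p.y j * rotX p.t v j)) v.t := by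
  have hd : DifferentiableAt ℝ (fun r => p * r) q :=
    ((contDiff_mul'.comp (contDiff_const.prodMk contDiff_id)).differentiable (by simp)) q
  have hl := hd.hasFDerivAt.hasLineDerivAt v
  have key : ∀ τ : ℝ, p * (q + τ • v) = p * q + τ • (mk (rotX p.t v) (rotY p.t v)
      (v.s + 1 / 2 * ∑ j, (p.x j * rotY p.t v j - p.y j * rotX p.t v j)) v.t :
        OscillatorGroup n lam) := by
    intro τ
    have ax : ∀ (a b : OscillatorGroup n lam) (c : ℝ) j, (a + c • b).x j = a.x j + c * b.x j :=
      fun _ _ _ _ => rfl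
    have ay : ∀ (a b : OscillatorGroup n lam) (c : ℝ) j, (a + c • b).y j = a.y j + c * b.y j :=
      fun _ _ _ _ => rfl
    have as : ∀ (a b : OscillatorGroup n lam) (c : ℝ), (a + c • b).s = a.s + c * b.s :=
      fun _ _ _ => rfl
    have at' : ∀ (a b : OscillatorGroup n lam) (c : ℝ), (a + c • b).t = a.t + c * b.t :=
      fun _ _ _ => rfl
    ext j
    · simp only [ax, mul_x, rotX, ay, mk_x]; ring
    · simp only [ax, mul_y, rotY, ay, mk_y]; ring
    · simp only [as, mul_s, mk_s, rotX, rotY, ax, ay]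
      have : ∑ j, (p.x j * (Real.sin (lam j * p.t) * (q.x j + τ * v.x j) +
            Real.cos (lam j * p.t) * (q.y j + τ * v.y j)) -
          p.y j * (Real.cos (lam j * p.t) * (q.x j + τ * v.x j) -
            Real.sin (lam j * p.t) * (q.y j + τ * v.y j))) =
          ∑ j, (p.x j * (Real.sin (lam j * p.t) * q.x j + Real.cos (lam j * p.t) * q.y j) -
            p.y j * (Real.cos (lam j * p.t) * q.x j - Real.sin (lam j * p.t) * q.y j)) +
          τ * ∑ j, (p.x j * (Real.sin (lam j * p.t) * v.x j + Real.cos (lam j * p.t) * v.y j) -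
            p.y j * (Real.cos (lam j * p.t) * v.x j - Real.sin (lam j * p.t) * v.y j)) := by
        rw [Finset.mul_sum, ← Finset.sum_add_distrib]
        exact Finset.sum_congr rfl fun j _ => by ring
      rw [this]; ring
    · simp only [at', mul_t, mk_t]; ring
  unfold HasLineDerivAt at hl
  simp only [key] at hl
  have h2 : HasDerivAt (fun τ : ℝ => p * q + τ • (mk (rotX p.t v) (rotY p.t v)
      (v.s + 1 / 2 * ∑ j, (p.x j * rotY p.t v j - p.y j * rotX p.t v j)) v.t :
        OscillatorGroup n lam)) _ 0 := ((hasDerivAt_id (0 : ℝ)).smul_const _).const_add _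
  simpa using hl.unique h2

/-- The Lie bracket: `[e_i, e_{n+j}] = δ_{ij} ξ`, `[ζ, e_j] = λ_j e_{n+j}`,
`[ζ, e_{n+j}] = -λ_j e_j`, all other brackets of basis vectors being zero. -/
theorem lie_bracket (v w : OscillatorGroup n lam) :
    VectorField.lieBracket ℝ (fun p => fderiv ℝ (fun r => p * r) 1 v)
      (fun p => fderiv ℝ (fun r => p * r) 1 w) (1 : OscillatorGroup n lam) =
    mk (fun j => -lam j * (v.t * w.y j - w.t * v.y j))
      (fun j => lam j * (v.t * w.x j - w.t * v.x j))
      (∑ j, (v.x j * w.y j - v.y j * w.x j)) 0 := by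
  have hfield : ∀ v w : OscillatorGroup n lam,
      fderiv ℝ (fun p : OscillatorGroup n lam => fderiv ℝ (fun r => p * r) 1 v) 1 w =
        mk (fun j => -lam j * w.t * v.y j) (fun j => lam j * w.t * v.x j)
          (1 / 2 * ∑ j, (w.x j * v.y j - w.y j * v.x j)) 0 := by
    intro v w
    simp only [fderiv_mul_left]
    have hX := fun j => (contDiff_rotX (lam := lam) j).comp
      ((contDiff_t (n := n) (lam := lam)).prodMk (contDiff_const (c := v)))
    have hY := fun j => (contDiff_rotY (lam := lam) j).comp
      ((contDiff_t (n := n) (lam := lam)).prodMk (contDiff_const (c := v)))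
    have hF : ContDiff ℝ ∞ fun p : OscillatorGroup n lam =>
        (mk (rotX p.t v) (rotY p.t v)
          (v.s + 1 / 2 * ∑ j, (p.x j * rotY p.t v j - p.y j * rotX p.t v j)) v.t :
            OscillatorGroup n lam) :=
      contDiff_coords hX hY (contDiff_const.add (contDiff_const.mul (ContDiff.sum fun j _ =>
        ((contDiff_x j).mul (hY j)).sub ((contDiff_y j).mul (hX j))))) contDiff_const
    have hl := ((hF.differentiable (by simp)) 1).hasFDerivAt.hasLineDerivAt w
    unfold HasLineDerivAt at hl
    have hc := fun i => (coordL i).hasFDerivAt.comp_hasDerivAt (0 : ℝ) hl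
    have et : ∀ τ : ℝ, (1 + τ • w : OscillatorGroup n lam).t = τ * w.t := fun τ => by
      change (0 : ℝ) + τ * w.t = _; ring
    have ex : ∀ (τ : ℝ) j, (1 + τ • w : OscillatorGroup n lam).x j = τ * w.x j := fun τ j => by
      change (0 : ℝ) + τ * w.x j = _; ring
    have ey : ∀ (τ : ℝ) j, (1 + τ • w : OscillatorGroup n lam).y j = τ * w.y j := fun τ j => by
      change (0 : ℝ) + τ * w.y j = _; ring
    have dcos : ∀ j, HasDerivAt (fun τ : ℝ => Real.cos (lam j * (τ * w.t))) 0 0 := fun j => by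
      simpa using (((hasDerivAt_id (0 : ℝ)).mul_const w.t).const_mul (lam j)).cos
    have dsin : ∀ j, HasDerivAt (fun τ : ℝ => Real.sin (lam j * (τ * w.t))) (lam j * w.t) 0 :=
      fun j => by simpa using (((hasDerivAt_id (0 : ℝ)).mul_const w.t).const_mul (lam j)).sin
    have dX : ∀ j, HasDerivAt (fun τ : ℝ => rotX (τ * w.t) v j) (-lam j * w.t * v.y j) 0 :=
      fun j => by
        simpa [rotX] using ((dcos j).mul_const (v.x j)).fun_sub ((dsin j).mul_const (v.y j))
    have dY : ∀ j, HasDerivAt (fun τ : ℝ => rotY (τ * w.t) v j) (lam j * w.t * v.x j) 0 :=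
      fun j => by
        simpa [rotY] using ((dsin j).mul_const (v.x j)).fun_add ((dcos j).mul_const (v.y j))
    ext j
    · refine (hc (Sum.inl (Sum.inl j))).unique ?_
      refine (dX j).congr_of_eventuallyEq (Filter.Eventually.of_forall fun τ => ?_)
      change rotX (1 + τ • w).t v j = _
      rw [et]
    · refine (hc (Sum.inl (Sum.inr j))).unique ?_
      refine (dY j).congr_of_eventuallyEq (Filter.Eventually.of_forall fun τ => ?_)
      change rotY (1 + τ • w).t v j = _
      rw [et]
    · refine (hc (Sum.inr 0)).unique ?_
      have hsum : HasDerivAt (fun τ : ℝ => v.s + 1 / 2 * ∑ j,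
          (τ * w.x j * rotY (τ * w.t) v j - τ * w.y j * rotX (τ * w.t) v j))
          (1 / 2 * ∑ j, (w.x j * v.y j - w.y j * v.x j)) 0 := by
        refine ((HasDerivAt.fun_sum fun j _ => ?_).const_mul _).const_add _
        have h := (((hasDerivAt_id (0 : ℝ)).mul_const (w.x j)).fun_mul (dY j)).fun_sub
          (((hasDerivAt_id (0 : ℝ)).mul_const (w.y j)).fun_mul (dX j))
        simpa [rotX, rotY] using h
      refine hsum.congr_of_eventuallyEq (Filter.Eventually.of_forall fun τ => ?_)
      change v.s + 1 / 2 * ∑ j, ((1 + τ • w).x j * rotY (1 + τ • w).t v j -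
        (1 + τ • w).y j * rotX (1 + τ • w).t v j) = _
      simp only [et, ex, ey]
    · refine (hc (Sum.inr 1)).unique ?_
      exact hasDerivAt_const _ v.t
  have h1 : ∀ v : OscillatorGroup n lam, fderiv ℝ (fun r => 1 * r) 1 v = v := by
    intro v; simp
  simp only [VectorField.lieBracket, h1, hfield]
  have sx : ∀ (a b : OscillatorGroup n lam) j, (a - b).x j = a.x j - b.x j := fun _ _ _ => rfl
  have sy : ∀ (a b : OscillatorGroup n lam) j, (a - b).y j = a.y j - b.y j := fun _ _ _ => rfl
  have ss : ∀ (a b : OscillatorGroup n lam), (a - b).s = a.s - b.s := fun _ _ => rfl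
  have st : ∀ (a b : OscillatorGroup n lam), (a - b).t = a.t - b.t := fun _ _ => rfl
  ext j
  · simp only [sx, mk_x]; ring
  · simp only [sy, mk_y]; ring
  · simp only [ss, mk_s]
    rw [← mul_sub, ← Finset.sum_sub_distrib, Finset.mul_sum]
    exact Finset.sum_congr rfl fun j _ => by ring
  · simp only [st, mk_t]; ring

/-- The left-invariant Riemannian metric for which the left-invariant frame
`e_1, …, e_{2n}, ξ, ζ` is orthonormal. -/
def metric (n : ℕ) (lam : Fin n → ℝ) : Riem.MetricField (OscillatorGroup n lam) := fun p =>
  (innerSL ℝ).bilinearComp (fderiv ℝ (fun q => p⁻¹ * q) p) (fderiv ℝ (fun q => p⁻¹ * q) p)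

/-- A vector field on the group is left-invariant: `(L_p)_* V = V` for all `p`. -/
def IsLeftInvariant (V : OscillatorGroup n lam → OscillatorGroup n lam) : Prop :=
  ∀ p q, fderiv ℝ (fun r => p * r) q (V q) = V (p * q)

end OscillatorGroup

end

/-! The rotations in the group law are isometries of the planes and preserve their area form, so
they drop out of the metric: `(G, g)` is the Riemannian product of a Heisenberg group and a line
(`metric_eq`). The `λ_j` survive only in the left-invariant fields. As they have a common value `l`,
the components `q` of such a field in the left-invariant frame of the product turn by `exp(l t J)`,
where `J` is the complex structure extended by zero (`IsLeftInvariant.eq_field`).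

For such a rotating field, the quadratic form `x ↦ ⟨(∇ dV)(x, x), W⟩` is an explicit polynomial
`hess` in the inner products of `x`, `q`, `ξ`, `ζ` and the horizontal and vertical parts `u`, `w` of
`W` (`sasaki_mapHessian`). Its `g`-trace is `-(⟨Jq, u⟩/8 + ⟨ξ, w⟩/4) ⟨ξ, q⟩ |J|² - (1/2 + l²) ⟨Jq,
Jw⟩` (`sum_hess`). If this vanishes for all `u` and all `w ⟂ q`, then `J = 0`, or `q = ±ζ`, or `q =
±ξ`, or `q ⟂ ξ, ζ` (`harmonic_cases`).

Minimality concerns the trace for the induced metric instead. In the first two cases `hess` is zero.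
In the other two, once `w ⟂ q`, it is a sum of products `α β` of linear forms with `α` vanishing on
the vector dual to `β`, and such a form has trace zero (`metricTrace_eq_zero`,
`meanCurvature_eq_zero`). -/

open scoped ContDiff Manifold InnerProductSpace

noncomputable section

/-! ### Positive definite forms, raising of indices, metric traces -/

namespace Riem

section General

variable {E : Type*} [NormedAddCommGroup E] [NormedSpace ℝ E]

theorem eq_of_form_eq (G : E →L[ℝ] E →L[ℝ] ℝ) (hpos : ∀ X, X ≠ 0 → 0 < G X X) {X Y : E}
    (h : ∀ Z, G X Z = G Y Z) : X = Y := by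
  by_contra hne
  have h1 := hpos (X - Y) (sub_ne_zero.2 hne)
  simp [h] at h1

theorem fderiv_apply_apply {F : Type*} [NormedAddCommGroup F] [NormedSpace ℝ F]
    {g : F → E →L[ℝ] E →L[ℝ] ℝ} {x : F} (hg : DifferentiableAt ℝ g x) (A : F) (X Y : E) :
    fderiv ℝ g x A X Y = fderiv ℝ (fun y => g y X Y) x A := by
  have h1 := hg.hasFDerivAt.clm_apply (hasFDerivAt_const X x)
  have h2 := h1.clm_apply (hasFDerivAt_const Y x)
  rw [h2.fderiv]
  simp

/-- The map `(X, Y) ↦ h((∇ df)(X, Y), W)` as a bilinear form. -/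
def mapHessianForm {F : Type*} [NormedAddCommGroup F] [NormedSpace ℝ F]
    (g : MetricField E) (h : MetricField F) (f : E → F) (x : E) (W : F) : E →ₗ[ℝ] E →ₗ[ℝ] ℝ :=
  LinearMap.mk₂ ℝ (fun X Y => h (f x) (mapHessian g h f x X Y) W)
    (by intros; simp only [mapHessian, covDeriv, map_add, map_sub, add_apply,
          sub_apply]; ring)
    (by intros; simp only [mapHessian, covDeriv, map_add, map_sub, map_smul,
          add_apply, sub_apply,
          smul_apply, smul_eq_mul]; ring)
    (by intros; simp only [mapHessian, covDeriv, map_add, map_sub, add_apply,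
          sub_apply]; ring)
    (by intros; simp only [mapHessian, covDeriv, map_add, map_sub, map_smul,
          add_apply, sub_apply,
          smul_apply, smul_eq_mul]; ring)

theorem mapHessianForm_apply {F : Type*} [NormedAddCommGroup F] [NormedSpace ℝ F]
    (g : MetricField E) (h : MetricField F) (f : E → F) (x : E) (W : F) (X Y : E) :
    mapHessianForm g h f x W X Y = h (f x) (mapHessian g h f x X Y) W := rfl

variable [FiniteDimensional ℝ E]

/-- A positive definite form on a finite-dimensional space identifies it with its dual. -/
theorem apply_inverse (G : E →L[ℝ] E →L[ℝ] ℝ) (hpos : ∀ X, X ≠ 0 → 0 < G X X)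
    (φ : E →L[ℝ] ℝ) : G (G.inverse φ) = φ := by
  have hinj : Function.Injective G.toLinearMap := by
    rw [← LinearMap.ker_eq_bot, LinearMap.ker_eq_bot']
    intro X hX
    by_contra hne
    have h := hpos X hne
    have h0 : G X = 0 := hX
    rw [h0] at h
    simp at h
  have hfin : Module.finrank ℝ E = Module.finrank ℝ (E →L[ℝ] ℝ) := by
    rw [← (LinearMap.toContinuousLinearMap (𝕜 := ℝ) (E := E) (F' := ℝ)).finrank_eq]
    exact (Subspace.dual_finrank_eq (K := ℝ) (V := E)).symm
  -- `inverse` is zero by default on maps that are not equivalences, so `G` has to be exhibited as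
  -- one.
  let e := (LinearEquiv.ofInjectiveOfFinrankEq G.toLinearMap hinj hfin).toContinuousLinearEquiv
  have he : (e : E →L[ℝ] E →L[ℝ] ℝ) = G := by ext; rfl
  rw [← he, ContinuousLinearMap.inverse_equiv]
  simp

/-- Lowering the index of the Christoffel symbols. -/
theorem metric_christoffel (g : MetricField E) (x : E) (hpos : ∀ X, X ≠ 0 → 0 < g x X X)
    (X Y Z : E) : g x (christoffel g x X Y) Z = christoffelLower g x X Y Z := by
  rw [christoffel_apply, apply_inverse _ hpos]

/-- The trace in terms of an orthonormal basis. -/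
theorem metricTrace_eq_sum {ι : Type*} [Fintype ι] (G : E →L[ℝ] E →L[ℝ] ℝ)
    (hpos : ∀ X, X ≠ 0 → 0 < G X X) (e : Module.Basis ι ℝ E)
    (he : ∀ i, G (e i) (e i) = 1) (he' : ∀ i j, i ≠ j → G (e i) (e j) = 0)
    (B : E →ₗ[ℝ] E →ₗ[ℝ] ℝ) :
    metricTrace G (fun X Y => B X Y) = ∑ j, B (e j) (e j) := by
  classical
  set b := Module.finBasis ℝ E with hb
  have hsharp : ∀ φ : E →L[ℝ] ℝ, G.inverse φ = ∑ j, φ (e j) • e j := by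
    intro φ
    refine eq_of_form_eq G hpos fun Z => ?_
    rw [apply_inverse G hpos]
    have : (φ : E →ₗ[ℝ] ℝ) = (G (∑ j, φ (e j) • e j)).toLinearMap := by
      refine e.ext fun k => ?_
      simp only [map_sum, map_smul, ContinuousLinearMap.coe_coe, sum_apply,
        smul_apply, smul_eq_mul]
      rw [Finset.sum_eq_single k (fun j _ hj => by rw [he' j k hj, mul_zero])
        (fun h => absurd (Finset.mem_univ k) h), he, mul_one]
    exact congrArg (fun ψ : E →ₗ[ℝ] ℝ => ψ Z) this
  unfold metricTrace
  simp only [hsharp, map_sum, map_smul]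
  rw [Finset.sum_comm]
  refine Finset.sum_congr rfl fun j _ => ?_
  have h := congrArg (fun X => B X (e j)) (b.sum_repr (e j))
  simp only [map_sum, map_smul, LinearMap.sum_apply, LinearMap.smul_apply, smul_eq_mul] at h
  exact h

/-- The trace with respect to a symmetric form is invariant under transposition. -/
theorem metricTrace_swap (G : E →L[ℝ] E →L[ℝ] ℝ) (hpos : ∀ X, X ≠ 0 → 0 < G X X)
    (hsymm : ∀ X Y, G X Y = G Y X) (B : E →ₗ[ℝ] E →ₗ[ℝ] ℝ) :
    metricTrace G (fun X Y => B Y X) = metricTrace G (fun X Y => B X Y) := by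
  unfold metricTrace
  set b := Module.finBasis ℝ E
  set s : Fin _ → E := fun i => G.inverse (LinearMap.toContinuousLinearMap (b.coord i)) with hs
  have hcoord : ∀ i X, b.repr X i = G (s i) X := fun i X => by
    rw [hs]; simp only [apply_inverse G hpos]; simp
  -- The coefficients are the Gram matrix of the dual basis; its symmetry is what makes both traces
  -- agree.
  have hexp : ∀ i, s i = ∑ j, G (s j) (s i) • b j := fun i => by
    conv_lhs => rw [← b.sum_repr (s i)]
    simp only [hcoord]
  change ∑ i, B (s i) (b i) = ∑ i, B (b i) (s i)
  have h1 : ∀ i, B (s i) (b i) = ∑ j, G (s j) (s i) * B (b j) (b i) := fun i => by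
    conv_lhs => rw [hexp i]
    simp [LinearMap.sum_apply]
  have h2 : ∀ i, B (b i) (s i) = ∑ j, G (s j) (s i) * B (b i) (b j) := fun i => by
    conv_lhs => rw [hexp i]
    simp
  simp only [h1, h2]
  rw [Finset.sum_comm]
  exact Finset.sum_congr rfl fun i _ => Finset.sum_congr rfl fun j _ => by rw [hsymm]

/-- Raising the index turns the sum into `α` applied to the expansion of `Z` in the basis. -/
theorem metricTrace_mul (G : E →L[ℝ] E →L[ℝ] ℝ) (hpos : ∀ X, X ≠ 0 → 0 < G X X)
    (hsymm : ∀ X Y, G X Y = G Y X) (α : E →ₗ[ℝ] ℝ) (Z : E) :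
    metricTrace G (fun X Y => α X * G Z Y) = α Z := by
  unfold metricTrace
  simp only [hsymm Z, apply_inverse G hpos]
  have h := congrArg α ((Module.finBasis ℝ E).sum_repr Z)
  simp only [map_sum, map_smul, smul_eq_mul] at h
  simpa [mul_comm] using h

/-- A bilinear form whose quadratic form is `∑ α_k β_k`, with `α_k` vanishing on the vector dual
to `β_k`, has trace zero. -/
theorem metricTrace_eq_zero {ι : Type*} [Fintype ι] (G : E →L[ℝ] E →L[ℝ] ℝ)
    (hpos : ∀ X, X ≠ 0 → 0 < G X X) (hsymm : ∀ X Y, G X Y = G Y X) (α : ι → E →ₗ[ℝ] ℝ) (Z : ι → E)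
    (hα : ∀ k, α k (Z k) = 0) (B : E →ₗ[ℝ] E →ₗ[ℝ] ℝ)
    (hB : ∀ X, B X X = ∑ k, α k X * G (Z k) X) :
    metricTrace G (fun X Y => B X Y) = 0 := by
  let C : ι → E →ₗ[ℝ] E →ₗ[ℝ] ℝ := fun k =>
    LinearMap.mk₂ ℝ (fun X Y => α k X * G (Z k) Y) (by intros; simp; ring) (by intros; simp; ring)
      (by intros; simp; ring) (by intros; simp; ring)
  have hC : ∀ k X Y, C k X Y = α k X * G (Z k) Y := fun _ _ _ => rfl
  -- Only the diagonal of `B` is known. Polarization gives its symmetric part, which determines the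
  -- trace by `metricTrace_swap`.
  have hpol : ∀ X Y, B X Y + B Y X = ∑ k, (C k X Y + C k Y X) := by
    intro X Y
    have h := hB (X + Y)
    simp only [map_add, LinearMap.add_apply, hB X, hB Y] at h
    have h' : ∑ k, (α k X + α k Y) * (G (Z k) X + G (Z k) Y) =
        ∑ k, α k X * G (Z k) X + ∑ k, α k Y * G (Z k) Y + ∑ k, (C k X Y + C k Y X) := by
      rw [← Finset.sum_add_distrib, ← Finset.sum_add_distrib]
      exact Finset.sum_congr rfl fun k _ => by rw [hC, hC]; ring
    linarith
  have hzero : ∀ k, metricTrace G (fun X Y => C k X Y) = 0 := fun k => by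
    simp only [hC]; rw [metricTrace_mul G hpos hsymm, hα]
  have h1 : metricTrace G (fun X Y => B X Y) + metricTrace G (fun X Y => B Y X) =
      ∑ k, (metricTrace G (fun X Y => C k X Y) + metricTrace G (fun X Y => C k Y X)) := by
    simp only [metricTrace, ← Finset.sum_add_distrib, hpol]
    rw [Finset.sum_comm]
  simp only [metricTrace_swap G hpos hsymm, hzero] at h1
  simp at h1
  linarith

theorem metricTrace_map {W : Type*} [AddCommMonoid W] [Module ℝ W] (G : E →L[ℝ] E →L[ℝ] ℝ)
    (φ : W →ₗ[ℝ] ℝ) (B : E → E → W) :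
    φ (metricTrace G B) = metricTrace G (fun X Y => φ (B X Y)) := by
  simp [metricTrace]

end General

end Riem

namespace Riem

/-- Used to reduce the explicit Fréchet derivatives below to one-variable derivatives,
differentiability being known beforehand. -/
theorem fderiv_eq_of_hasDerivAt_line {E F : Type*} [NormedAddCommGroup E] [NormedSpace ℝ E]
    [NormedAddCommGroup F] [NormedSpace ℝ F] {f : E → F} {x A : E} {d : F}
    (hf : DifferentiableAt ℝ f x) (h : HasDerivAt (fun τ : ℝ => f (x + τ • A)) d 0) :
    fderiv ℝ f x A = d :=
  (hf.hasFDerivAt.hasLineDerivAt A).unique h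

end Riem

/-! ### The Heisenberg group times a line: metric, connection, Sasaki metric -/

/-- The data that determine the product of a Heisenberg group and a line: a skew operator `J`
with kernel spanned by the orthonormal vectors `ξ` and `ζ`, which is a complex structure on the
orthogonal complement of its kernel. -/
structure HeisenbergData (E : Type*) [NormedAddCommGroup E] [InnerProductSpace ℝ E] where
  /-- The complex structure, extended by zero. -/
  J : E →L[ℝ] E
  /-- The generator of the centre of the Heisenberg group. -/
  ξ : E
  /-- The direction of the line. -/
  ζ : E
  inner_J : ∀ X Y, ⟪X, J Y⟫_ℝ = -⟪J X, Y⟫_ℝ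
  J_J : ∀ X, J (J X) = -X + ⟪ξ, X⟫_ℝ • ξ + ⟪ζ, X⟫_ℝ • ζ
  J_ξ : J ξ = 0
  J_ζ : J ζ = 0
  inner_ξ_ξ : ⟪ξ, ξ⟫_ℝ = 1
  inner_ζ_ζ : ⟪ζ, ζ⟫_ℝ = 1
  inner_ξ_ζ : ⟪ξ, ζ⟫_ℝ = 0

namespace HeisenbergData

variable {E : Type*} [NormedAddCommGroup E] [InnerProductSpace ℝ E] (H : HeisenbergData E)

theorem inner_J_ξ (X : E) : ⟪H.J X, H.ξ⟫_ℝ = 0 := by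
  have h := H.inner_J X H.ξ
  rw [H.J_ξ, inner_zero_right] at h
  linarith

theorem inner_ξ_J (X : E) : ⟪H.ξ, H.J X⟫_ℝ = 0 := by rw [real_inner_comm, inner_J_ξ]

theorem inner_J_ζ (X : E) : ⟪H.J X, H.ζ⟫_ℝ = 0 := by
  have h := H.inner_J X H.ζ
  rw [H.J_ζ, inner_zero_right] at h
  linarith

theorem inner_ζ_J (X : E) : ⟪H.ζ, H.J X⟫_ℝ = 0 := by rw [real_inner_comm, inner_J_ζ]

theorem inner_ζ_ξ : ⟪H.ζ, H.ξ⟫_ℝ = 0 := by rw [real_inner_comm, inner_ξ_ζ]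

theorem inner_J_self (X : E) : ⟪H.J X, X⟫_ℝ = 0 := by
  have h := H.inner_J X X
  rw [real_inner_comm] at h
  linarith

theorem inner_J_swap (X Y : E) : ⟪H.J X, Y⟫_ℝ = -⟪H.J Y, X⟫_ℝ := by
  rw [← H.inner_J, real_inner_comm, H.inner_J, real_inner_comm, H.inner_J]

theorem inner_J_J (X Y : E) : ⟪H.J X, H.J Y⟫_ℝ =
    ⟪X, Y⟫_ℝ - ⟪H.ξ, X⟫_ℝ * ⟪H.ξ, Y⟫_ℝ - ⟪H.ζ, X⟫_ℝ * ⟪H.ζ, Y⟫_ℝ := by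
  rw [H.inner_J, H.J_J]
  simp only [inner_add_left, inner_neg_left, real_inner_smul_left]
  ring

/-- The left-invariant coframe of the Heisenberg group times a line. -/
def coframe (p : E) : E →L[ℝ] E :=
  ContinuousLinearMap.id ℝ E - (innerSL ℝ ((1 / 2 : ℝ) • H.J p)).smulRight H.ξ

/-- The left-invariant frame of the Heisenberg group times a line. -/
def frame (p : E) : E →L[ℝ] E :=
  ContinuousLinearMap.id ℝ E + (innerSL ℝ ((1 / 2 : ℝ) • H.J p)).smulRight H.ξ

theorem coframe_apply (p X : E) : H.coframe p X = X - (1 / 2 * ⟪H.J p, X⟫_ℝ) • H.ξ := by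
  simp [coframe]

theorem frame_apply (p X : E) : H.frame p X = X + (1 / 2 * ⟪H.J p, X⟫_ℝ) • H.ξ := by
  simp [frame]

-- The coframe differs from the identity by a multiple of `ξ`, which `J` kills; so the base point
-- disappears from every term that contains `J`.
@[simp] theorem J_coframe (p X : E) : H.J (H.coframe p X) = H.J X := by
  simp [coframe_apply, H.J_ξ]

@[simp] theorem J_frame (p X : E) : H.J (H.frame p X) = H.J X := by
  simp [frame_apply, H.J_ξ]

@[simp] theorem coframe_frame (p X : E) : H.coframe p (H.frame p X) = X := by
  simp only [coframe_apply, frame_apply, inner_add_right, real_inner_smul_right, inner_J_ξ]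
  module

@[simp] theorem frame_coframe (p X : E) : H.frame p (H.coframe p X) = X := by
  simp only [coframe_apply, frame_apply, inner_sub_right, real_inner_smul_right, inner_J_ξ]
  module

@[simp] theorem coframe_ξ (p : E) : H.coframe p H.ξ = H.ξ := by
  simp [coframe_apply, inner_J_ξ]

theorem inner_J_coframe (p X Y : E) : ⟪H.J X, H.coframe p Y⟫_ℝ = ⟪H.J X, Y⟫_ℝ := by
  simp [coframe_apply, inner_sub_right, real_inner_smul_right, inner_J_ξ]

theorem inner_ζ_coframe (p X : E) : ⟪H.ζ, H.coframe p X⟫_ℝ = ⟪H.ζ, X⟫_ℝ := by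
  simp [coframe_apply, inner_sub_right, real_inner_smul_right, inner_ζ_ξ]

theorem coframe_injective (p : E) : Function.Injective (H.coframe p) :=
  Function.LeftInverse.injective (H.frame_coframe p)

theorem contDiff_coframe {F : Type*} [NormedAddCommGroup F] [NormedSpace ℝ F] {f v : F → E}
    (hf : ContDiff ℝ ∞ f) (hv : ContDiff ℝ ∞ v) :
    ContDiff ℝ ∞ fun y => H.coframe (f y) (v y) := by
  simp only [coframe_apply]
  exact hv.sub ((contDiff_const.mul ((H.J.contDiff.comp hf).inner ℝ hv)).smul contDiff_const)

theorem hasDerivAt_coframe {γ v : ℝ → E} {γ' v' : E} {τ : ℝ}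
    (hγ : HasDerivAt γ γ' τ) (hv : HasDerivAt v v' τ) :
    HasDerivAt (fun τ => H.coframe (γ τ) (v τ))
      (H.coframe (γ τ) v' - (1 / 2 * ⟪H.J γ', v τ⟫_ℝ) • H.ξ) τ := by
  simp only [coframe_apply]
  have h := hv.sub ((((H.J.hasFDerivAt.comp_hasDerivAt τ hγ).inner ℝ hv).const_mul
    (1 / 2 : ℝ)).smul_const H.ξ)
  refine h.congr_deriv ?_
  simp only [Function.comp_apply]
  module

theorem hasDerivAt_line (p X : E) (τ : ℝ) : HasDerivAt (fun τ : ℝ => p + τ • X) X τ := by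
  simpa using ((hasDerivAt_id τ).smul_const X).const_add p

/-- The left-invariant metric on the Heisenberg group times a line. -/
def metric : Riem.MetricField E := fun p =>
  (innerSL ℝ).bilinearComp (H.coframe p) (H.coframe p)

theorem metric_apply (p X Y : E) : H.metric p X Y = ⟪H.coframe p X, H.coframe p Y⟫_ℝ := rfl

theorem metric_pos (p X : E) (hX : X ≠ 0) : 0 < H.metric p X X := by
  rw [metric_apply]
  refine real_inner_self_pos.2 fun h => hX (H.coframe_injective p ?_)
  rw [h, map_zero]

/-- The vertical component, in the coframe, of a vector tangent to the tangent bundle. -/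
def vert (q A : E × E) : E := H.coframe q.1 A.2
  - (1 / 2 : ℝ) • (⟪H.ξ, H.coframe q.1 q.2⟫_ℝ • H.J A.1 + ⟪H.ξ, H.coframe q.1 A.1⟫_ℝ • H.J q.2)

theorem contDiff_vert (A : E × E) : ContDiff ℝ ∞ fun q => H.vert q A := by
  unfold vert
  have h := fun {v : E × E → E} (hv : ContDiff ℝ ∞ v) => H.contDiff_coframe contDiff_fst hv
  exact (h contDiff_const).sub (contDiff_const.smul
    (((contDiff_const.inner ℝ (h contDiff_snd)).smul contDiff_const).add
      ((contDiff_const.inner ℝ (h contDiff_const)).smul (H.J.contDiff.comp contDiff_snd))))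

/-- The derivative of `vert q B` in the direction `A`. -/
def dvert (q A B : E × E) : E :=
  -((1 / 2 * ⟪H.J A.1, B.2⟫_ℝ) • H.ξ)
    - (1 / 2 * (⟪H.ξ, H.coframe q.1 A.2⟫_ℝ - 1 / 2 * ⟪H.J A.1, q.2⟫_ℝ)) • H.J B.1
    + (1 / 4 * ⟪H.J A.1, B.1⟫_ℝ) • H.J q.2 - (1 / 2 * ⟪H.ξ, H.coframe q.1 B.1⟫_ℝ) • H.J A.2

theorem hasDerivAt_vert (q A B : E × E) :
    HasDerivAt (fun τ : ℝ => H.vert (q + τ • A) B) (H.dvert q A B) 0 := by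
  have h1 := hasDerivAt_line q.1 A.1 0
  have h2 := hasDerivAt_line q.2 A.2 0
  have hc := fun Z : E => H.hasDerivAt_coframe h1 (hasDerivAt_const 0 Z)
  have hv := H.hasDerivAt_coframe h1 h2
  have hi := fun {f : ℝ → E} {f' : E} (hf : HasDerivAt f f' 0) =>
    (hasDerivAt_const (0 : ℝ) H.ξ).inner ℝ hf
  have h := (hc B.2).sub (((((hi hv).smul_const (H.J B.1)).add
    ((hi (hc B.1)).smul (H.J.hasFDerivAt.comp_hasDerivAt 0 h2)))).const_smul (1 / 2 : ℝ))
  refine h.congr_deriv ?_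
  simp only [zero_smul, add_zero, map_zero, zero_sub, inner_zero_left, inner_neg_right,
    inner_sub_right, real_inner_smul_right, H.inner_ξ_ξ, dvert, Function.comp_apply]
  module

variable [FiniteDimensional ℝ E]

theorem contDiff_metric : ContDiff ℝ ∞ H.metric := by
  refine contDiff_clm_apply_iff.2 fun X => contDiff_clm_apply_iff.2 fun Y => ?_
  exact (H.contDiff_coframe contDiff_id contDiff_const).inner ℝ
    (H.contDiff_coframe contDiff_id contDiff_const)

theorem fderiv_metric (p A X Y : E) : fderiv ℝ H.metric p A X Y =
    -(1 / 2) * (⟪H.J A, X⟫_ℝ * ⟪H.ξ, H.coframe p Y⟫_ℝ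
      + ⟪H.J A, Y⟫_ℝ * ⟪H.ξ, H.coframe p X⟫_ℝ) := by
  rw [Riem.fderiv_apply_apply (H.contDiff_metric.differentiable (by simp) p)]
  refine Riem.fderiv_eq_of_hasDerivAt_line ?_ ?_
  · exact ((H.contDiff_coframe contDiff_id contDiff_const).inner ℝ
      (H.contDiff_coframe contDiff_id contDiff_const)).differentiable (by simp) p
  · have h := fun Z => H.hasDerivAt_coframe (hasDerivAt_line p A 0) (hasDerivAt_const 0 Z)
    refine ((h X).inner ℝ (h Y)).congr_deriv ?_
    simp only [zero_smul, add_zero, map_zero, zero_sub, inner_neg_left, inner_neg_right,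
      real_inner_smul_left, real_inner_smul_right, real_inner_comm _ H.ξ]
    rw [real_inner_comm H.ξ (H.coframe p X)]
    ring

theorem christoffel_metric (p X Y : E) : Riem.christoffel H.metric p X Y =
    -((1 / 2 : ℝ) • H.frame p (⟪H.ξ, H.coframe p Y⟫_ℝ • H.J X
      + ⟪H.ξ, H.coframe p X⟫_ℝ • H.J Y)) := by
  refine Riem.eq_of_form_eq _ (H.metric_pos p) fun Z => ?_
  rw [Riem.metric_christoffel _ _ (H.metric_pos p), Riem.christoffelLower_apply, metric_apply]
  simp only [fderiv_metric, map_neg, map_smul, coframe_frame, inner_neg_left, inner_add_left,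
    real_inner_smul_left, inner_J_coframe]
  -- Skewness of `J` cancels the two terms in `⟨ξ, coframe Z⟩` and doubles the others.
  rw [H.inner_J_swap Z X, H.inner_J_swap Z Y, H.inner_J_swap Y X]
  ring

/-- The connection map in terms of the coframe. -/
theorem coframe_connectionMap (q A : E × E) :
    H.coframe q.1 (Riem.connectionMap H.metric q A) = H.coframe q.1 A.2
      - (1 / 2 : ℝ) • (⟪H.ξ, H.coframe q.1 q.2⟫_ℝ • H.J A.1
        + ⟪H.ξ, H.coframe q.1 A.1⟫_ℝ • H.J q.2) := by
  have h : Riem.connectionMap H.metric q A = A.2 + Riem.christoffel H.metric q.1 A.1 q.2 := rfl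
  rw [h, christoffel_metric, map_add, map_neg, map_smul, coframe_frame]
  module

/-- The coframe and `vert` trivialize the Sasaki metric, so that its derivatives reduce to
`hasDerivAt_coframe` and `hasDerivAt_vert`. -/
theorem sasaki_apply (q A B : E × E) : Riem.sasaki H.metric q A B =
    ⟪H.coframe q.1 A.1, H.coframe q.1 B.1⟫_ℝ + ⟪H.vert q A, H.vert q B⟫_ℝ := by
  unfold vert
  rw [← coframe_connectionMap, ← coframe_connectionMap]
  rfl

theorem sasaki_pos (q A : E × E) (hA : A ≠ 0) : 0 < Riem.sasaki H.metric q A A := by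
  rw [sasaki_apply]
  have h1 := real_inner_self_nonneg (x := H.coframe q.1 A.1)
  have h2 := real_inner_self_nonneg (x := H.vert q A)
  by_contra hle
  have h3 : H.coframe q.1 A.1 = 0 := inner_self_eq_zero (𝕜 := ℝ).1 (by linarith)
  have h4 : H.vert q A = 0 := inner_self_eq_zero (𝕜 := ℝ).1 (by linarith)
  have h5 : A.1 = 0 := H.coframe_injective q.1 (by rw [h3, map_zero])
  simp only [vert, h5, map_zero, smul_zero, inner_zero_right, zero_smul, add_zero, sub_zero] at h4
  exact hA (Prod.ext h5 (H.coframe_injective q.1 (by rw [h4]; simp)))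

theorem contDiff_sasaki_apply (A B : E × E) :
    ContDiff ℝ ∞ fun q => Riem.sasaki H.metric q A B := by
  simp only [sasaki_apply]
  exact ((H.contDiff_coframe contDiff_fst contDiff_const).inner ℝ
    (H.contDiff_coframe contDiff_fst contDiff_const)).add
      ((H.contDiff_vert A).inner ℝ (H.contDiff_vert B))

theorem contDiff_sasaki : ContDiff ℝ ∞ (Riem.sasaki H.metric) :=
  contDiff_clm_apply_iff.2 fun A => contDiff_clm_apply_iff.2 fun B => H.contDiff_sasaki_apply A B

theorem fderiv_sasaki (q A B C : E × E) : fderiv ℝ (Riem.sasaki H.metric) q A B C =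
    -(1 / 2) * (⟪H.J A.1, B.1⟫_ℝ * ⟪H.ξ, H.coframe q.1 C.1⟫_ℝ
      + ⟪H.J A.1, C.1⟫_ℝ * ⟪H.ξ, H.coframe q.1 B.1⟫_ℝ)
    + (⟪H.dvert q A B, H.vert q C⟫_ℝ + ⟪H.vert q B, H.dvert q A C⟫_ℝ) := by
  rw [Riem.fderiv_apply_apply (H.contDiff_sasaki.differentiable (by simp) q)]
  refine Riem.fderiv_eq_of_hasDerivAt_line
    ((H.contDiff_sasaki_apply B C).differentiable (by simp) q) ?_
  simp only [sasaki_apply]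
  have h := fun Z => H.hasDerivAt_coframe (hasDerivAt_line q.1 A.1 0) (hasDerivAt_const 0 Z)
  refine (((h B.1).inner ℝ (h C.1)).add
    ((H.hasDerivAt_vert q A B).inner ℝ (H.hasDerivAt_vert q A C))).congr_deriv ?_
  simp only [zero_smul, add_zero, map_zero, zero_sub, inner_neg_left, inner_neg_right,
    real_inner_smul_left, real_inner_smul_right]
  rw [real_inner_comm H.ξ (H.coframe q.1 B.1)]
  ring

end HeisenbergData

/-! ### Rotating fields and their second fundamental form -/

namespace HeisenbergData

variable {E : Type*} [NormedAddCommGroup E] [InnerProductSpace ℝ E] (H : HeisenbergData E)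

/-- The vector field with components `Q` in the left-invariant frame. -/
def field (Q : E → E) (p : E) : E := H.frame p (Q p)

/-- The covariant derivative of a field whose components `q` rotate with speed `l` along `ζ`. -/
def nabla (l : ℝ) (q x : E) : E :=
  (1 / 2 * ⟪H.J x, q⟫_ℝ) • H.ξ - (1 / 2 * ⟪H.ξ, q⟫_ℝ) • H.J x
    + (l * ⟪H.ζ, x⟫_ℝ - 1 / 2 * ⟪H.ξ, x⟫_ℝ) • H.J q

/-- The components `Q` of a vector field rotate with speed `l` along `ζ`. -/
structure IsRotating (l : ℝ) (Q : E → E) : Prop where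
  contDiff : ContDiff ℝ ∞ Q
  fderiv_apply : ∀ p X, fderiv ℝ Q p X = (l * ⟪H.ζ, X⟫_ℝ) • H.J (Q p)

/-- The component `⟨R(q, ∇_x q) x, u⟩ + ⟨∇²_{x,x} q, w⟩`, with respect to the vector with horizontal
part `u` and vertical part `w`, of the second fundamental form of the map that a rotating vector
field with components `q` defines. -/
def hess (l : ℝ) (q u w x : E) : ℝ :=
  let μ := l * ⟪H.ζ, x⟫_ℝ - 1 / 2 * ⟪H.ξ, x⟫_ℝ
  let c := ⟪H.ξ, q⟫_ℝ
  1 / 4 * (μ * ⟪H.J q, H.J x⟫_ℝ - 1 / 2 * c * ⟪H.J x, H.J x⟫_ℝ) * ⟪H.J q, u⟫_ℝ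
  + 1 / 4 * ⟪H.J q, x⟫_ℝ * (1 / 2 * c * ⟪H.J u, H.J x⟫_ℝ - μ * ⟪H.J q, H.J u⟫_ℝ)
  - 1 / 2 * (-(1 / 2) * c * ⟪H.J q, H.J x⟫_ℝ + μ * ⟪H.J q, H.J q⟫_ℝ) * ⟪H.J u, x⟫_ℝ
  - 1 / 8 * ⟪H.J q, x⟫_ℝ * (-⟪H.J q, H.J x⟫_ℝ * ⟪H.ξ, u⟫_ℝ + ⟪H.ξ, x⟫_ℝ * ⟪H.J q, H.J u⟫_ℝ)
  - 1 / 4 * c * (-μ * ⟪H.J q, x⟫_ℝ * ⟪H.ξ, u⟫_ℝ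
      + ⟪H.ξ, x⟫_ℝ * (1 / 2 * c * ⟪H.J u, x⟫_ℝ + μ * ⟪H.J q, u⟫_ℝ))
  + (⟪H.J q, H.J x⟫_ℝ * (μ - 1 / 4 * ⟪H.ξ, x⟫_ℝ) - 1 / 4 * c * ⟪H.J x, H.J x⟫_ℝ) * ⟪H.ξ, w⟫_ℝ
  - μ ^ 2 * ⟪H.J q, H.J w⟫_ℝ - 1 / 4 * ⟪H.J q, x⟫_ℝ * ⟪H.J w, x⟫_ℝ
  + 1 / 4 * c * ⟪H.ξ, x⟫_ℝ * ⟪H.J w, H.J x⟫_ℝ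

variable {H} {l : ℝ} {Q : E → E}

theorem IsRotating.contDiff_field (hQ : H.IsRotating l Q) : ContDiff ℝ ∞ (H.field Q) := by
  unfold field
  simp only [frame_apply]
  exact hQ.contDiff.add ((contDiff_const.mul
    ((H.J.contDiff.comp contDiff_id).inner ℝ hQ.contDiff)).smul contDiff_const)

theorem IsRotating.hasDerivAt_line (hQ : H.IsRotating l Q) (p X : E) : HasDerivAt (fun τ : ℝ => Q (p + τ • X))
    ((l * ⟪H.ζ, X⟫_ℝ) • H.J (Q p)) 0 := by
  rw [← hQ.fderiv_apply]
  exact (hQ.contDiff.differentiable (by simp) p).hasFDerivAt.hasLineDerivAt X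

theorem IsRotating.fderiv_field (hQ : H.IsRotating l Q) (p X : E) : fderiv ℝ (H.field Q) p X =
    (l * ⟪H.ζ, X⟫_ℝ) • H.frame p (H.J (Q p)) + (1 / 2 * ⟪H.J X, Q p⟫_ℝ) • H.ξ := by
  refine Riem.fderiv_eq_of_hasDerivAt_line (hQ.contDiff_field.differentiable (by simp) p) ?_
  have h1 := HeisenbergData.hasDerivAt_line p X 0
  have h2 := hQ.hasDerivAt_line p X
  unfold field
  simp only [frame_apply]
  refine (h2.add ((((H.J.hasFDerivAt.comp_hasDerivAt 0 h1).inner ℝ h2).const_mul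
    (1 / 2 : ℝ)).smul_const H.ξ)).congr_deriv ?_
  simp only [zero_smul, add_zero, Function.comp_apply, real_inner_smul_right]
  module

/-- The diagonal values suffice: traces depend only on the quadratic form. -/
theorem IsRotating.fderiv_fderiv_field (hQ : H.IsRotating l Q) (p X : E) : fderiv ℝ (fderiv ℝ (H.field Q)) p X X =
    (l * ⟪H.ζ, X⟫_ℝ) ^ 2 • H.frame p (H.J (H.J (Q p)))
      + (l * ⟪H.ζ, X⟫_ℝ * ⟪H.J X, H.J (Q p)⟫_ℝ) • H.ξ := by
  have hs : ContDiff ℝ ∞ (fderiv ℝ (H.field Q)) :=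
    hQ.contDiff_field.fderiv_right (m := ∞) (by simp)
  have hd : DifferentiableAt ℝ (fderiv ℝ (H.field Q)) p := hs.differentiable (by simp) p
  have h0 : fderiv ℝ (fderiv ℝ (H.field Q)) p X X =
      fderiv ℝ (fun y => fderiv ℝ (H.field Q) y X) p X := by
    rw [(hd.hasFDerivAt.clm_apply (hasFDerivAt_const X p)).fderiv]
    simp
  rw [h0]
  refine Riem.fderiv_eq_of_hasDerivAt_line (hd.clm_apply (differentiableAt_const X)) ?_
  simp only [hQ.fderiv_field, frame_apply]
  have h1 := HeisenbergData.hasDerivAt_line p X 0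
  have h2 := hQ.hasDerivAt_line p X
  have h3 := H.J.hasFDerivAt.comp_hasDerivAt 0 h2
  refine (((h3.add ((((H.J.hasFDerivAt.comp_hasDerivAt 0 h1).inner ℝ h3).const_mul
    (1 / 2 : ℝ)).smul_const H.ξ)).const_smul (l * ⟪H.ζ, X⟫_ℝ)).add
    ((((hasDerivAt_const 0 (H.J X)).inner ℝ h2).const_mul
      (1 / 2 : ℝ)).smul_const H.ξ)).congr_deriv ?_
  simp only [zero_smul, add_zero, Function.comp_apply, real_inner_smul_right, map_smul,
    inner_zero_left]
  module

theorem IsRotating.fderiv_graphMap (hQ : H.IsRotating l Q) (p X : E) :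
    fderiv ℝ (Riem.graphMap (H.field Q)) p X = (X, fderiv ℝ (H.field Q) p X) := by
  have hd := hQ.contDiff_field.differentiable (by simp) p
  have h : HasFDerivAt (Riem.graphMap (H.field Q)) _ p := (hasFDerivAt_id p).prodMk hd.hasFDerivAt
  rw [h.fderiv]
  rfl

theorem IsRotating.contDiff_graphMap (hQ : H.IsRotating l Q) : ContDiff ℝ ∞ (Riem.graphMap (H.field Q)) :=
  contDiff_id.prodMk hQ.contDiff_field

theorem IsRotating.fderiv_fderiv_graphMap (hQ : H.IsRotating l Q) (p X : E) :
    fderiv ℝ (fderiv ℝ (Riem.graphMap (H.field Q))) p X X =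
      (0, fderiv ℝ (fderiv ℝ (H.field Q)) p X X) := by
  have hs : ContDiff ℝ ∞ (fderiv ℝ (H.field Q)) :=
    hQ.contDiff_field.fderiv_right (m := ∞) (by simp)
  have hd : DifferentiableAt ℝ (fderiv ℝ (H.field Q)) p := hs.differentiable (by simp) p
  have hs' : ContDiff ℝ ∞ (fderiv ℝ (Riem.graphMap (H.field Q))) :=
    hQ.contDiff_graphMap.fderiv_right (m := ∞) (by simp)
  have hd' : DifferentiableAt ℝ (fderiv ℝ (Riem.graphMap (H.field Q))) p :=
    hs'.differentiable (by simp) p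
  have h := hd'.hasFDerivAt.clm_apply (hasFDerivAt_const X p)
  have h2 := (hasFDerivAt_const X p).prodMk (hd.hasFDerivAt.clm_apply (hasFDerivAt_const X p))
  simp only [hQ.fderiv_graphMap] at h
  have h3 := congrArg (fun T => T X) (h.unique h2)
  simpa using h3

/-- The vertical part of `V_* X` is `∇_X V`; this justifies the formula for `nabla`. -/
theorem IsRotating.vert_graphMap (hQ : H.IsRotating l Q) (p X : E) :
    H.vert (Riem.graphMap (H.field Q) p) (fderiv ℝ (Riem.graphMap (H.field Q)) p X) =
      H.nabla l (Q p) (H.coframe p X) := by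
  rw [hQ.fderiv_graphMap]
  simp only [vert, nabla, Riem.graphMap, hQ.fderiv_field, field, map_add, map_smul, coframe_frame,
    coframe_ξ, J_frame, J_coframe, inner_ζ_coframe]
  module

variable [FiniteDimensional ℝ E]

/-- Paired with `W`, the Christoffel symbol of the Sasaki metric is of the first kind, so
`fderiv_sasaki` is enough and that metric need not be inverted. Expressed through `x`, `q`, `u`,
`w`, everything becomes independent of the base point. -/
theorem IsRotating.sasaki_mapHessian (hQ : H.IsRotating l Q) (p X : E) (W : E × E) {x q u w : E}
    (hx : H.coframe p X = x) (hq : Q p = q) (hu : H.coframe p W.1 = u)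
    (hw : H.vert (Riem.graphMap (H.field Q) p) W = w) :
    Riem.sasaki H.metric (Riem.graphMap (H.field Q) p)
      (Riem.mapHessian H.metric (Riem.sasaki H.metric) (Riem.graphMap (H.field Q)) p X X) W =
    H.hess l q u w x := by
  set f := Riem.graphMap (H.field Q) with hf
  have hJX : H.J X = H.J x := by rw [← hx, J_coframe]
  have hJW : H.J W.1 = H.J u := by rw [← hu, J_coframe]
  have hf1 : (f p).1 = p := rfl
  have hf2 : H.coframe p (f p).2 = q := by rw [hf]; simp [Riem.graphMap, field, hq]
  have hJf : H.J (f p).2 = H.J q := by rw [← hf2, J_coframe]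
  have hζ : ⟪H.ζ, X⟫_ℝ = ⟪H.ζ, x⟫_ℝ := by rw [← hx, inner_ζ_coframe]
  have hW2 : H.coframe p W.2 = w + (1 / 2 : ℝ) • (⟪H.ξ, q⟫_ℝ • H.J u + ⟪H.ξ, u⟫_ℝ • H.J q) := by
    rw [← hw, vert, hf1, hf2, hJf, hJW, hu]; module
  have hJW2 : H.J W.2 = H.J w + (1 / 2 : ℝ) • (⟪H.ξ, q⟫_ℝ • H.J (H.J u)
      + ⟪H.ξ, u⟫_ℝ • H.J (H.J q)) := by
    rw [← H.J_coframe p, hW2]; simp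
  have hA := hQ.fderiv_graphMap p X
  have hvA := hQ.vert_graphMap p X
  rw [← hf] at hA hvA
  rw [hq, hx] at hvA
  set A := fderiv ℝ f p X with hAdef
  have hA1 : A.1 = X := by rw [hA]
  have hA2 : H.coframe p A.2 = (l * ⟪H.ζ, x⟫_ℝ) • H.J q + (1 / 2 * ⟪H.J x, q⟫_ℝ) • H.ξ := by
    rw [hA]; simp [hQ.fderiv_field, hq, hζ, hJX]
  have hJA2 : H.J A.2 = (l * ⟪H.ζ, x⟫_ℝ) • H.J (H.J q) := by
    rw [← H.J_coframe p, hA2]; simp [H.J_ξ]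
  have hbase : ∀ Y Z : E, ⟪H.J Y, Z⟫_ℝ = ⟪H.J Y, H.coframe p Z⟫_ℝ := fun Y Z =>
    (H.inner_J_coframe p Y Z).symm
  have hD : H.vert (f p) (0, fderiv ℝ (fderiv ℝ (H.field Q)) p X X) =
      (l * ⟪H.ζ, x⟫_ℝ) ^ 2 • H.J (H.J q) + (l * ⟪H.ζ, x⟫_ℝ * ⟪H.J x, H.J q⟫_ℝ) • H.ξ := by
    simp [vert, hf1, hQ.fderiv_fderiv_field, hq, hζ, hJX]
  have hΓ : H.coframe p (Riem.christoffel H.metric p X X) = -(⟪H.ξ, x⟫_ℝ • H.J x) := by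
    rw [christoffel_metric, map_neg, map_smul, coframe_frame, hx, hJX]; module
  have hvΓ := hQ.vert_graphMap p (Riem.christoffel H.metric p X X)
  have hfst : (fderiv ℝ f p (Riem.christoffel H.metric p X X)).1 =
      Riem.christoffel H.metric p X X := by rw [hf, hQ.fderiv_graphMap]
  rw [hΓ, hq, ← hf] at hvΓ
  rw [Riem.mapHessian, Riem.covDeriv, map_sub, map_add, sub_apply, add_apply,
    Riem.metric_christoffel _ _ (H.sasaki_pos _), Riem.christoffelLower_apply, ← hAdef,
    fderiv_sasaki, fderiv_sasaki, sasaki_apply, sasaki_apply]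
  rw [hvA, hw, hf1, hu]
  rw [hQ.fderiv_fderiv_graphMap, hD, hvΓ, hfst, hΓ]
  simp only [dvert, hf1]
  rw [hbase _ (f p).2, hbase _ A.1, hbase _ A.2, hbase _ W.1, hbase _ W.2, hbase _ A.1,
    hbase _ A.2, hbase _ (f p).2, hA1, hx, hJX, hJW, hJf, hf2, hJA2, hA2, hJW2, hu, hW2]
  simp only [nabla, hess, map_zero, map_add, map_neg, map_smul, H.J_J, H.J_ξ, H.J_ζ,
    inner_add_left, inner_add_right, inner_sub_left, inner_sub_right, inner_neg_left,
    inner_neg_right, real_inner_smul_left, real_inner_smul_right, inner_J_ζ,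
    H.inner_ξ_ξ, H.inner_ξ_ζ, inner_zero_left, inner_J_self, H.inner_J,
    real_inner_comm H.ξ]
  -- Each pairing gets one fixed order of its arguments, so that a polynomial identity remains.
  simp only [H.inner_J_swap x q, H.inner_J_swap x u, H.inner_J_swap x w, H.inner_J_swap u q, real_inner_comm x q, real_inner_comm x u, real_inner_comm x w,
    real_inner_comm u q, real_inner_comm w q]
  ring

end HeisenbergData

/-! ### Harmonic and minimal rotating fields -/

namespace HeisenbergData

variable {E : Type*} [NormedAddCommGroup E] [InnerProductSpace ℝ E] (H : HeisenbergData E)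

/-- The projection to the orthogonal complement of `ξ` and `ζ`. -/
def hor (X : E) : E := X - ⟪H.ξ, X⟫_ℝ • H.ξ - ⟪H.ζ, X⟫_ℝ • H.ζ

theorem inner_hor (X Y : E) : ⟪H.hor X, Y⟫_ℝ = ⟪H.J X, H.J Y⟫_ℝ := by
  rw [inner_J_J, hor]
  simp only [inner_sub_left, real_inner_smul_left]

theorem inner_ξ_hor (X : E) : ⟪H.ξ, H.hor X⟫_ℝ = 0 := by
  rw [real_inner_comm, inner_hor, H.J_ξ, inner_zero_right]

theorem inner_ζ_hor (X : E) : ⟪H.ζ, H.hor X⟫_ℝ = 0 := by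
  rw [real_inner_comm, inner_hor, H.J_ζ, inner_zero_right]

theorem inner_J_hor (X Y : E) : ⟪H.J X, H.hor Y⟫_ℝ = ⟪H.J X, Y⟫_ℝ := by
  simp [hor, inner_sub_right, real_inner_smul_right, inner_J_ξ, inner_J_ζ]

theorem inner_J_J_J (X Y : E) : ⟪H.J X, H.J (H.J Y)⟫_ℝ = -⟪H.J X, Y⟫_ℝ := by
  rw [inner_J_J, inner_ξ_J, inner_ζ_J, H.inner_J]
  ring

/-- Apart from a multiple of `|Jx|²`, `hess` is a sum of products of two linear forms, whose traces
can be read off. -/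
theorem hess_eq (l : ℝ) (q u w x : E) : H.hess l q u w x =
    -(1 / 8 * ⟪H.J q, u⟫_ℝ + 1 / 4 * ⟪H.ξ, w⟫_ℝ) * ⟪H.ξ, q⟫_ℝ * ⟪H.J x, H.J x⟫_ℝ
    + ⟪(1 / 4 * ⟪H.J q, u⟫_ℝ + ⟪H.ξ, w⟫_ℝ) • H.hor q
        + (1 / 4 * (⟪H.ξ, q⟫_ℝ * ⟪H.ξ, u⟫_ℝ - ⟪H.J q, H.J u⟫_ℝ)) • H.J q
        - (1 / 2 * ⟪H.J q, H.J q⟫_ℝ) • H.J u - (1 / 4 * ⟪H.ξ, q⟫_ℝ * ⟪H.J q, u⟫_ℝ) • H.ξ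
        - ⟪H.J q, H.J w⟫_ℝ • (l • H.ζ - (1 / 2 : ℝ) • H.ξ), x⟫_ℝ
      * ⟪l • H.ζ - (1 / 2 : ℝ) • H.ξ, x⟫_ℝ
    + ⟪(1 / 8 * ⟪H.ξ, q⟫_ℝ) • H.hor u + (1 / 8 * ⟪H.ξ, u⟫_ℝ) • H.hor q
        - (1 / 4 : ℝ) • H.J w, x⟫_ℝ * ⟪H.J q, x⟫_ℝ
    + ⟪(1 / 4 * ⟪H.ξ, q⟫_ℝ) • H.J u, x⟫_ℝ * ⟪H.hor q, x⟫_ℝ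
    + ⟪(1 / 4 * ⟪H.ξ, q⟫_ℝ) • H.hor w - (1 / 8 * ⟪H.ξ, q⟫_ℝ ^ 2) • H.J u
        - (1 / 8 * ⟪H.J q, H.J u⟫_ℝ) • H.J q - (1 / 4 * ⟪H.ξ, w⟫_ℝ) • H.hor q, x⟫_ℝ
      * ⟪H.ξ, x⟫_ℝ := by
  simp only [hess, inner_add_left, inner_sub_left, real_inner_smul_left, inner_hor]
  ring

/-- The trace of the second fundamental form. -/
theorem sum_hess {ι : Type*} [Fintype ι] (ε : OrthonormalBasis ι ℝ E) (l : ℝ) (q u w : E) :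
    ∑ j, H.hess l q u w (ε j) =
      -(1 / 8 * ⟪H.J q, u⟫_ℝ + 1 / 4 * ⟪H.ξ, w⟫_ℝ) * ⟪H.ξ, q⟫_ℝ
          * ∑ j, ⟪H.J (ε j), H.J (ε j)⟫_ℝ - (1 / 2 + l ^ 2) * ⟪H.J q, H.J w⟫_ℝ := by
  -- Parseval: the trace of a product of linear forms is the inner product of their vectors.
  have hε : ∀ a b : E, ∑ j, ⟪a, ε j⟫_ℝ * ⟪b, ε j⟫_ℝ = ⟪a, b⟫_ℝ := fun a b => by
    rw [← ε.sum_inner_mul_inner a b]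
    exact Finset.sum_congr rfl fun j _ => by rw [real_inner_comm b]
  simp only [hess_eq, Finset.sum_add_distrib, hε, ← Finset.mul_sum]
  -- The constant `1/2 + l²` is `|lζ - ξ/2|² = l² + 1/4` plus `1/4` from the product of `Jw` and
  -- `Jq`. The remaining terms in `⟨ξ, q⟩ ⟨Jq, u⟩`, with coefficients `1/8`, `1/8`, `-1/4`, cancel.
  simp only [inner_add_left, inner_sub_left, real_inner_smul_left, inner_sub_right,
    real_inner_smul_right, inner_hor, H.J_ξ, H.J_ζ, inner_zero_right, inner_J_ξ, inner_J_ζ,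
    H.inner_ξ_ξ, H.inner_ξ_ζ, H.inner_ζ_ζ, inner_ζ_ξ, inner_J_hor, inner_J_J_J,
    inner_J_self, H.inner_J_swap u q, real_inner_comm (H.J q) (H.J w)]
  ring

variable {H} {l : ℝ} {Q : E → E}

/-- The connection is metric: the differential of `g(v, v)` is `2 g(v, K W)`, with `K` the
connection map. -/
theorem mem_tangentUnit (p : E) (W : E × E) :
    W ∈ Riem.tangentUnit H.metric (Riem.graphMap (H.field Q) p) ↔
      ⟪Q p, H.vert (Riem.graphMap (H.field Q) p) W⟫_ℝ = 0 := by
  have hs : ContDiff ℝ ∞ fun z : E × E => H.metric z.1 z.2 z.2 :=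
    (H.contDiff_coframe contDiff_fst contDiff_snd).inner ℝ
      (H.contDiff_coframe contDiff_fst contDiff_snd)
  set f := Riem.graphMap (H.field Q) with hf
  have hf1 : (f p).1 = p := rfl
  have hf2 : H.coframe p (f p).2 = Q p := by rw [hf]; simp [Riem.graphMap, field]
  have hJf : H.J (f p).2 = H.J (Q p) := by rw [← hf2, J_coframe]
  have hd : fderiv ℝ (fun z : E × E => H.metric z.1 z.2 z.2) (f p) W =
      2 * ⟪Q p, H.vert (f p) W⟫_ℝ := by
    refine Riem.fderiv_eq_of_hasDerivAt_line (hs.differentiable (by simp) _) ?_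
    have h := H.hasDerivAt_coframe (HeisenbergData.hasDerivAt_line (f p).1 W.1 0)
      (HeisenbergData.hasDerivAt_line (f p).2 W.2 0)
    refine (h.inner ℝ h).congr_deriv ?_
    simp only [zero_smul, add_zero, hf1, hf2, vert, hJf, inner_sub_left, inner_sub_right,
      real_inner_smul_left, real_inner_smul_right, inner_add_right,
      ← H.inner_J_coframe p W.1 (f p).2, real_inner_comm (Q p) (H.coframe p W.2),
      real_inner_comm H.ξ (Q p), H.inner_J, H.inner_J_self, H.inner_J_swap W.1 (Q p)]
    ring
  change fderiv ℝ (fun z : E × E => H.metric z.1 z.2 z.2) (f p) W = 0 ↔ _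
  rw [hd]
  simp

/-- Tangent vectors of the tangent bundle with given horizontal and vertical components. -/
theorem exists_vert_eq (q : E × E) (u w : E) :
    ∃ W : E × E, H.coframe q.1 W.1 = u ∧ H.vert q W = w :=
  ⟨(H.frame q.1 u, H.frame q.1 (w + (1 / 2 : ℝ) • (⟪H.ξ, H.coframe q.1 q.2⟫_ℝ • H.J u
    + ⟪H.ξ, u⟫_ℝ • H.J q.2))), by simp, by simp [vert]⟩

theorem inner_self_of_isUnitField (hV : Riem.IsUnitField H.metric (H.field Q)) (p : E) :
    ⟪Q p, Q p⟫_ℝ = 1 := by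
  have h : H.metric p (H.field Q p) (H.field Q p) = 1 := hV p
  simpa [metric_apply, field] using h

variable [FiniteDimensional ℝ E]

theorem IsRotating.sasaki_tension (hQ : H.IsRotating l Q) (p : E) (W : E × E) {ι : Type*} [Fintype ι]
    (ε : OrthonormalBasis ι ℝ E) :
    Riem.sasaki H.metric (Riem.graphMap (H.field Q) p)
      (Riem.tension H.metric (Riem.sasaki H.metric) (Riem.graphMap (H.field Q)) p) W =
    ∑ j, H.hess l (Q p) (H.coframe p W.1) (H.vert (Riem.graphMap (H.field Q) p) W) (ε j) := by
  -- The frame carries a Euclidean orthonormal basis to a `g`-orthonormal one.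
  let Φ : E ≃ₗ[ℝ] E := LinearEquiv.ofLinearMap (H.frame p).toLinearMap (H.coframe p).toLinearMap
    (by ext; simp) (by ext; simp)
  let e : Module.Basis ι ℝ E := ε.toBasis.map Φ
  have he : ∀ j, H.coframe p (e j) = ε j := fun j => by simp [e, Φ]
  have h1 : Riem.sasaki H.metric (Riem.graphMap (H.field Q) p)
      (Riem.tension H.metric (Riem.sasaki H.metric) (Riem.graphMap (H.field Q)) p) W =
      Riem.metricTrace (H.metric p) (fun X Y => Riem.mapHessianForm H.metric
        (Riem.sasaki H.metric) (Riem.graphMap (H.field Q)) p W X Y) :=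
    Riem.metricTrace_map (H.metric p)
      (((Riem.sasaki H.metric (Riem.graphMap (H.field Q) p)).flip W).toLinearMap) _
  rw [h1, Riem.metricTrace_eq_sum _ (H.metric_pos p) e]
  · refine Finset.sum_congr rfl fun j _ => ?_
    rw [Riem.mapHessianForm_apply]
    exact hQ.sasaki_mapHessian p (e j) W (he j) rfl rfl rfl
  · intro i
    rw [metric_apply, he, real_inner_self_eq_norm_sq, ε.norm_eq_one, one_pow]
  · intro i j hij
    rw [metric_apply, he, he, ε.inner_eq_zero hij]

/-- The rotating fields that define harmonic maps. -/
theorem IsRotating.harmonic_cases (hQ : H.IsRotating l Q)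
    (hV : Riem.DefinesHarmonicMap H.metric (H.field Q)) (p : E) :
    H.J = 0 ∨ (H.J (Q p) = 0 ∧ ⟪H.ξ, Q p⟫_ℝ = 0) ∨ (H.J (Q p) = 0 ∧ ⟪H.ζ, Q p⟫_ℝ = 0) ∨
      (⟪H.ξ, Q p⟫_ℝ = 0 ∧ ⟪H.ζ, Q p⟫_ℝ = 0) := by
  have hq := inner_self_of_isUnitField hV.1 p
  let ε := stdOrthonormalBasis ℝ E
  set N := ∑ j, ⟪H.J (ε j), H.J (ε j)⟫_ℝ with hN
  set q := Q p with hqdef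
  have key : ∀ u w : E, ⟪q, w⟫_ℝ = 0 → -(1 / 8 * ⟪H.J q, u⟫_ℝ + 1 / 4 * ⟪H.ξ, w⟫_ℝ) * ⟪H.ξ, q⟫_ℝ
      * N - (1 / 2 + l ^ 2) * ⟪H.J q, H.J w⟫_ℝ = 0 := by
    intro u w hw
    obtain ⟨W, hWu, hWw⟩ := exists_vert_eq (H := H) (Riem.graphMap (H.field Q) p) u w
    have h := hV.2 p W ((mem_tangentUnit p W).2 (by rw [hWw]; exact hw))
    rw [hQ.sasaki_tension p W ε, sum_hess, hWw] at h
    have hWu' : H.coframe p W.1 = u := hWu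
    rwa [hWu'] at h
  by_cases hJ : H.J = 0
  · exact Or.inl hJ
  -- `N` is the squared Hilbert–Schmidt norm of `J`.
  have hN0 : N ≠ 0 := by
    intro h0
    refine hJ (ContinuousLinearMap.coe_injective (ε.toBasis.ext fun j => ?_))
    have := (Finset.sum_eq_zero_iff_of_nonneg fun j _ => real_inner_self_nonneg).1 h0 j
      (Finset.mem_univ j)
    simpa using inner_self_eq_zero (𝕜 := ℝ).1 this
  by_cases hJq : H.J q = 0
  -- Here `q` lies in the plane of `ξ` and `ζ`; the test vector is `q` turned by a right angle in
  -- that plane.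
  · have h := key 0 (⟪H.ζ, q⟫_ℝ • H.ξ - ⟪H.ξ, q⟫_ℝ • H.ζ) (by
      simp only [inner_sub_right, real_inner_smul_right, real_inner_comm H.ξ q,
        real_inner_comm H.ζ q]
      ring)
    simp only [hJq, inner_zero_left, inner_sub_right, real_inner_smul_right, H.inner_ξ_ξ,
      H.inner_ξ_ζ] at h
    have h' : ⟪H.ζ, q⟫_ℝ * ⟪H.ξ, q⟫_ℝ * N = 0 := by linarith
    rcases mul_eq_zero.1 h' with h' | h'
    · rcases mul_eq_zero.1 h' with h' | h'
      · exact Or.inr (Or.inr (Or.inl ⟨hJq, h'⟩))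
      · exact Or.inr (Or.inl ⟨hJq, h'⟩)
    · exact absurd h' hN0
  · have hpos : ⟪H.J q, H.J q⟫_ℝ ≠ 0 := inner_self_ne_zero.2 hJq
    -- A horizontal test vector isolates `⟨ξ, q⟩`; the component of `ζ` orthogonal to `q` then
    -- isolates `⟨ζ, q⟩`.
    have h := key (H.J q) 0 (inner_zero_right q)
    simp only [inner_zero_right, map_zero] at h
    have h' : ⟪H.J q, H.J q⟫_ℝ * (⟪H.ξ, q⟫_ℝ * N) = 0 := by linarith
    have hc : ⟪H.ξ, q⟫_ℝ = 0 := by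
      have := (mul_eq_zero.1 h').resolve_left hpos
      exact (mul_eq_zero.1 this).resolve_right hN0
    have h2 := key 0 (H.ζ - ⟪H.ζ, q⟫_ℝ • q) (by
      simp only [inner_sub_right, real_inner_smul_right, hq, real_inner_comm H.ζ q]
      ring)
    simp only [hc, map_sub, map_smul, H.J_ζ, inner_sub_right, inner_zero_right,
      real_inner_smul_right] at h2
    have h3 : (1 / 2 + l ^ 2) * (⟪H.ζ, q⟫_ℝ * ⟪H.J q, H.J q⟫_ℝ) = 0 := by linarith
    have h4 := (mul_eq_zero.1 h3).resolve_left (by positivity)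
    exact Or.inr (Or.inr (Or.inr ⟨hc, (mul_eq_zero.1 h4).resolve_right hpos⟩))

theorem IsRotating.pullback_apply (hQ : H.IsRotating l Q) (p X Y : E) :
    Riem.pullback (Riem.sasaki H.metric) (Riem.graphMap (H.field Q)) p X Y =
      ⟪H.coframe p X, H.coframe p Y⟫_ℝ
        + ⟪H.nabla l (Q p) (H.coframe p X), H.nabla l (Q p) (H.coframe p Y)⟫_ℝ := by
  have h : Riem.pullback (Riem.sasaki H.metric) (Riem.graphMap (H.field Q)) p X Y =
    Riem.sasaki H.metric (Riem.graphMap (H.field Q) p)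
      (fderiv ℝ (Riem.graphMap (H.field Q)) p X) (fderiv ℝ (Riem.graphMap (H.field Q)) p Y) := rfl
  rw [h, sasaki_apply, hQ.vert_graphMap, hQ.vert_graphMap, hQ.fderiv_graphMap, hQ.fderiv_graphMap]
  rfl

theorem IsRotating.pullback_pos (hQ : H.IsRotating l Q) (p X : E) (hX : X ≠ 0) :
    0 < Riem.pullback (Riem.sasaki H.metric) (Riem.graphMap (H.field Q)) p X X := by
  rw [hQ.pullback_apply]
  exact add_pos_of_pos_of_nonneg (H.metric_pos p X hX) real_inner_self_nonneg

/-- The mean curvature vanishes if the second fundamental form is a sum of products of linear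
forms which are orthogonal for the induced metric. -/
theorem IsRotating.meanCurvature_eq_zero (hQ : H.IsRotating l Q) (p : E) (W : E × E)
    (hW : Riem.IsNormalAt H.metric (H.field Q) p W) {q u w : E} (hq : Q p = q)
    (hu : H.coframe p W.1 = u) (hw : H.vert (Riem.graphMap (H.field Q) p) W = w)
    {ι : Type*} [Fintype ι] (α β z : ι → E)
    (hz : ∀ k x, ⟪z k, x⟫_ℝ + ⟪H.nabla l q (z k), H.nabla l q x⟫_ℝ = ⟪β k, x⟫_ℝ)
    (hα : ∀ k, ⟪α k, z k⟫_ℝ = 0)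
    (hB : ∀ x, H.hess l q u w x = ∑ k, ⟪α k, x⟫_ℝ * ⟪β k, x⟫_ℝ) :
    Riem.meanCurvature H.metric (H.field Q) p W = 0 := by
  have h1 : Riem.secondFundamentalForm H.metric (H.field Q) p W = fun X Y =>
      Riem.mapHessianForm H.metric (Riem.sasaki H.metric) (Riem.graphMap (H.field Q)) p W X Y := by
    funext X Y
    -- The two Hessians differ by a vector tangent to `V(M)`, to which `W` is orthogonal.
    rw [Riem.mapHessianForm_apply, Riem.mapHessian, map_sub, sub_apply, hW.2, sub_zero]
    rfl
  rw [Riem.meanCurvature, h1, Riem.metricTrace_eq_zero _ (hQ.pullback_pos p)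
    (fun X Y => by rw [hQ.pullback_apply, hQ.pullback_apply, real_inner_comm,
      real_inner_comm (H.nabla _ _ _)])
    (fun k => (innerSL ℝ (α k)).toLinearMap ∘ₗ (H.coframe p).toLinearMap)
    (fun k => H.frame p (z k)), mul_zero]
  · intro k
    simpa using hα k
  · intro X
    rw [Riem.mapHessianForm_apply, hQ.sasaki_mapHessian p X W rfl hq hu hw, hB]
    refine Finset.sum_congr rfl fun k _ => ?_
    rw [hQ.pullback_apply, coframe_frame, hq, hz]
    rfl

/-- A rotating vector field that defines a harmonic map is minimal. -/
theorem IsRotating.isMinimalField (hQ : H.IsRotating l Q)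
    (hV : Riem.DefinesHarmonicMap H.metric (H.field Q)) :
    Riem.IsMinimalField H.metric (H.field Q) := by
  refine ⟨hV.1, fun p W hW => ?_⟩
  have hunit := inner_self_of_isUnitField hV.1 p
  have hqw := (mem_tangentUnit p W).1 hW.1
  have hcases := hQ.harmonic_cases hV p
  have hmean := fun {q u w : E} (hq : Q p = q) (hu : H.coframe p W.1 = u)
    (hw : H.vert (Riem.graphMap (H.field Q) p) W = w) (n : ℕ) =>
    hQ.meanCurvature_eq_zero p W hW hq hu hw (ι := Fin n)
  -- From here on the problem is algebra in one tangent space.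
  generalize Q p = q at *
  generalize H.coframe p W.1 = u at *
  generalize H.vert (Riem.graphMap (H.field Q) p) W = w at *
  replace hmean := @hmean q u w rfl rfl rfl
  have hzero : (∀ x, H.hess l q u w x = 0) →
      Riem.meanCurvature H.metric (H.field Q) p W = 0 := fun h =>
    hmean 0 (fun _ => 0) (fun _ => 0) (fun _ => 0)
      (fun k => k.elim0) (fun k => k.elim0) (fun x => by simp [h])
  rcases hcases with hJ | ⟨hJ, hc⟩ | ⟨hJ, hd⟩ | ⟨hc, hd⟩
  · exact hzero fun x => by simp [hess, hJ]
  -- Here `q = ±ζ` is parallel: every term of `hess` contains `Jq` or `⟨ξ, q⟩`.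
  · exact hzero fun x => by simp [hess, hJ, hc]
  · have hξ : q = ⟪H.ξ, q⟫_ℝ • H.ξ := by
      have h := H.J_J q
      rw [hJ, map_zero, hd, zero_smul, add_zero] at h
      exact (neg_add_eq_zero.1 h.symm)
    have hξw : ⟪H.ξ, q⟫_ℝ * ⟪H.ξ, w⟫_ℝ = 0 := by
      rw [hξ, real_inner_smul_left] at hqw; exact hqw
    -- As `∇_ξ q = 0` and `∇q` has no component along `ξ`, the vector `ξ` is its own dual for the
    -- induced metric.
    refine hmean 1
      (fun _ => (1 / 4 * ⟪H.ξ, q⟫_ℝ) • H.hor w - (1 / 8 * ⟪H.ξ, q⟫_ℝ ^ 2) • H.J u)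
      (fun _ => H.ξ) (fun _ => H.ξ) (fun _ x => ?_) (fun _ => ?_) (fun x => ?_)
    · simp [nabla, hJ, H.J_ξ]
    · simp only [inner_sub_left, real_inner_smul_left, inner_hor, H.J_ξ, inner_zero_right,
        inner_J_ξ]
      ring
    · have hh : H.hor q = 0 := by
        rw [hor, hd, zero_smul, sub_zero, ← hξ, sub_self]
      rw [hess_eq]
      simp only [hh, hJ, smul_zero, inner_zero_left, sub_zero, add_zero, mul_zero, zero_mul,
        zero_smul, Fin.sum_univ_one]
      linear_combination (-(1 / 4) * ⟪H.J x, H.J x⟫_ℝ) * hξw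
  · have hJJ : ⟪H.J q, H.J q⟫_ℝ = 1 := by rw [inner_J_J, hunit, hc, hd]; ring
    have hJw : ⟪H.J q, H.J w⟫_ℝ = 0 := by rw [inner_J_J, hqw, hc, hd]; ring
    have hnabla : ∀ x, H.nabla l q x = -((1 / 2 * ⟪H.J q, x⟫_ℝ) • H.ξ)
        + (l * ⟪H.ζ, x⟫_ℝ - 1 / 2 * ⟪H.ξ, x⟫_ℝ) • H.J q := fun x => by
      rw [nabla, hc, H.inner_J_swap x q]; module
    -- On the orthogonal complement of `ξ` and `ζ`, `∇_x q = -⟨Jq, x⟩ ξ/2`, so the induced metric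
    -- only stretches the unit vector `Jq`, by `1 + 1/4 = 5/4`. Dualizing multiplies that component
    -- by `4/5 = 1 - 1/5`.
    have hsharp : ∀ m, ⟪H.ξ, m⟫_ℝ = 0 → ⟪H.ζ, m⟫_ℝ = 0 → ∀ x,
        ⟪m - (1 / 5 * ⟪H.J q, m⟫_ℝ) • H.J q, x⟫_ℝ
          + ⟪H.nabla l q (m - (1 / 5 * ⟪H.J q, m⟫_ℝ) • H.J q), H.nabla l q x⟫_ℝ = ⟪m, x⟫_ℝ := by
      intro m h1 h2 x
      simp only [hnabla, inner_sub_left, inner_sub_right, inner_add_left, inner_add_right,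
        inner_neg_left, inner_neg_right, real_inner_smul_left, real_inner_smul_right, h1, h2,
        inner_ξ_J, inner_ζ_J, inner_J_ξ, H.inner_ξ_ξ, hJJ]
      ring
    obtain ⟨β, hβ⟩ : ∃ β : Fin 3 → E, β = ![(1 / 4 * ⟪H.J q, u⟫_ℝ + ⟪H.ξ, w⟫_ℝ) • H.hor q
          - (1 / 4 * ⟪H.J q, H.J u⟫_ℝ) • H.J q - (1 / 2 : ℝ) • H.J u,
        -((1 / 8 * ⟪H.J q, H.J u⟫_ℝ) • H.J q) - (1 / 4 * ⟪H.ξ, w⟫_ℝ) • H.hor q, H.J q] := ⟨_, rfl⟩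
    have hβξ : ∀ k, ⟪H.ξ, β k⟫_ℝ = 0 := fun k => by
      rw [hβ]
      fin_cases k <;> simp [inner_sub_right, real_inner_smul_right, inner_ξ_hor, inner_ξ_J]
    have hβζ : ∀ k, ⟪H.ζ, β k⟫_ℝ = 0 := fun k => by
      rw [hβ]
      fin_cases k <;> simp [inner_sub_right, real_inner_smul_right, inner_ζ_hor, inner_ζ_J]
    -- The first two `α` are combinations of `ξ` and `ζ`, orthogonal to the horizontal duals. The
    -- third has to be orthogonal to `Jq` only, and is, because `⟨Jq, Jw⟩ = 0`.
    refine hmean 3 ![l • H.ζ - (1 / 2 : ℝ) • H.ξ, H.ξ,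
        (1 / 8 * ⟪H.ξ, u⟫_ℝ) • H.hor q - (1 / 4 : ℝ) • H.J w] β _
      (fun k => hsharp _ (hβξ k) (hβζ k)) (fun k => ?_) (fun x => ?_)
    · fin_cases k
      · simp [inner_sub_left, inner_sub_right, real_inner_smul_left, real_inner_smul_right, hβξ,
          hβζ, inner_ξ_J, inner_ζ_J]
      · simp [inner_sub_right, real_inner_smul_right, hβξ, inner_ξ_J]
      · simp [inner_sub_left, inner_sub_right, real_inner_smul_left, real_inner_smul_right,
          inner_hor, inner_J_J_J, inner_J_self, real_inner_comm (H.J q) (H.J w), hJw, hβ]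
    · rw [hess_eq, hβ]
      simp only [hc, hJJ, hJw, Fin.sum_univ_three, Matrix.cons_val_zero, Matrix.cons_val_one,
        Matrix.cons_val, inner_add_left, inner_sub_left, inner_neg_left, real_inner_smul_left]
      ring

end HeisenbergData

/-! ### The oscillator group as a Heisenberg group times a line -/

namespace HeisenbergData

variable {E : Type*} [NormedAddCommGroup E] [InnerProductSpace ℝ E] (H : HeisenbergData E)

/-- The components of the vector field obtained from `v` by rotating with speed `l` along `ζ`. -/
def rotate (l : ℝ) (v p : E) : E :=
  Real.cos (l * ⟪H.ζ, p⟫_ℝ) • H.hor v + Real.sin (l * ⟪H.ζ, p⟫_ℝ) • H.J v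
    + (⟪H.ξ, v⟫_ℝ • H.ξ + ⟪H.ζ, v⟫_ℝ • H.ζ)

/-- `rotate` is `exp(lτJ) v` with `τ = ⟨ζ, p⟩`, written out by means of `J² = -hor`. -/
theorem isRotating_rotate (l : ℝ) (v : E) : H.IsRotating l (H.rotate l v) := by
  have hsmooth : ContDiff ℝ ∞ (H.rotate l v) := by
    have h : ContDiff ℝ ∞ fun p : E => l * ⟪H.ζ, p⟫_ℝ :=
      contDiff_const.mul (contDiff_const.inner ℝ contDiff_id)
    exact (((Real.contDiff_cos.comp h).smul contDiff_const).add
      ((Real.contDiff_sin.comp h).smul contDiff_const)).add contDiff_const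
  refine ⟨hsmooth, fun p X => ?_⟩
  refine Riem.fderiv_eq_of_hasDerivAt_line (hsmooth.differentiable (by simp) p) ?_
  have h := ((hasDerivAt_const (0 : ℝ) H.ζ).inner ℝ (hasDerivAt_line p X 0)).const_mul l
  refine ((((h.cos.smul_const (H.hor v)).add (h.sin.smul_const (H.J v)))).add_const
    (⟪H.ξ, v⟫_ℝ • H.ξ + ⟪H.ζ, v⟫_ℝ • H.ζ)).congr_deriv ?_
  simp only [rotate, hor, map_add, map_sub, map_smul, H.J_ξ, H.J_ζ, H.J_J, inner_zero_left,
    zero_smul, add_zero]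
  module

end HeisenbergData

namespace OscillatorGroup

variable {n : ℕ} {lam : Fin n → ℝ}

theorem inner_eq (p q : OscillatorGroup n lam) :
    ⟪p, q⟫_ℝ = ∑ j, (p.x j * q.x j + p.y j * q.y j) + p.s * q.s + p.t * q.t := by
  have h : ⟪p, q⟫_ℝ = ∑ i : (Fin n ⊕ Fin n) ⊕ Fin 2, ⟪WithLp.ofLp p i, WithLp.ofLp q i⟫_ℝ := rfl
  rw [h, Fintype.sum_sum_type, Fintype.sum_sum_type, Fin.sum_univ_two, Finset.sum_add_distrib]
  simp only [RCLike.inner_apply, conj_trivial]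
  simp only [x, y, s, t, mul_comm]
  ring

section linear

variable (p q : OscillatorGroup n lam) (c : ℝ) (j : Fin n)

@[simp] theorem add_x : (p + q).x j = p.x j + q.x j := rfl
@[simp] theorem add_y : (p + q).y j = p.y j + q.y j := rfl
@[simp] theorem add_s : (p + q).s = p.s + q.s := rfl
@[simp] theorem add_t : (p + q).t = p.t + q.t := rfl
@[simp] theorem sub_x : (p - q).x j = p.x j - q.x j := rfl
@[simp] theorem sub_y : (p - q).y j = p.y j - q.y j := rfl
@[simp] theorem sub_s : (p - q).s = p.s - q.s := rfl
@[simp] theorem sub_t : (p - q).t = p.t - q.t := rfl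
@[simp] theorem neg_x : (-p).x j = -p.x j := rfl
@[simp] theorem neg_y : (-p).y j = -p.y j := rfl
@[simp] theorem neg_s : (-p).s = -p.s := rfl
@[simp] theorem neg_t : (-p).t = -p.t := rfl
@[simp] theorem smul_x : (c • p).x j = c * p.x j := rfl
@[simp] theorem smul_y : (c • p).y j = c * p.y j := rfl
@[simp] theorem smul_s : (c • p).s = c * p.s := rfl
@[simp] theorem smul_t : (c • p).t = c * p.t := rfl
@[simp] theorem zero_x : (0 : OscillatorGroup n lam).x j = 0 := rfl
@[simp] theorem zero_y : (0 : OscillatorGroup n lam).y j = 0 := rfl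
@[simp] theorem zero_s : (0 : OscillatorGroup n lam).s = 0 := rfl
@[simp] theorem zero_t : (0 : OscillatorGroup n lam).t = 0 := rfl

end linear

/-- The complex structure on the span of `e_1, …, e_{2n}`, extended by zero. -/
def complexStructure (n : ℕ) (lam : Fin n → ℝ) :
    OscillatorGroup n lam →ₗ[ℝ] OscillatorGroup n lam where
  toFun p := mk (fun j => -p.y j) p.x 0 0
  map_add' p q := by ext j <;> simp; ring
  map_smul' c p := by ext j <;> simp

/-- The Riemannian manifold underlying the oscillator group is the product of a Heisenberg group
and a line. -/
def heisenbergData (n : ℕ) (lam : Fin n → ℝ) : HeisenbergData (OscillatorGroup n lam) where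
  J := (complexStructure n lam).toContinuousLinearMap
  ξ := mk 0 0 1 0
  ζ := mk 0 0 0 1
  inner_J p q := by
    simp only [LinearMap.coe_toContinuousLinearMap', complexStructure, LinearMap.coe_mk,
      AddHom.coe_mk, inner_eq, mk_x, mk_y, mk_s, mk_t]
    have : ∑ j, (p.x j * -q.y j + p.y j * q.x j) = -∑ j, (-p.y j * q.x j + p.x j * q.y j) := by
      rw [← Finset.sum_neg_distrib]
      exact Finset.sum_congr rfl fun j _ => by ring
    rw [this]; ring
  J_J p := by
    ext j <;> simp [complexStructure, inner_eq]
  J_ξ := by ext j <;> simp [complexStructure]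
  J_ζ := by ext j <;> simp [complexStructure]
  inner_ξ_ξ := by rw [inner_eq]; simp
  inner_ζ_ζ := by rw [inner_eq]; simp
  inner_ξ_ζ := by simp [inner_eq]

theorem heisenbergData_J (p : OscillatorGroup n lam) :
    (heisenbergData n lam).J p = mk (fun j => -p.y j) p.x 0 0 := rfl

theorem heisenbergData_ξ : (heisenbergData n lam).ξ = mk 0 0 1 0 := rfl

theorem heisenbergData_ζ : (heisenbergData n lam).ζ = mk 0 0 0 1 := rfl

theorem inner_heisenbergData_J (p q : OscillatorGroup n lam) :
    ⟪(heisenbergData n lam).J p, q⟫_ℝ = ∑ j, (p.x j * q.y j - p.y j * q.x j) := by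
  simp only [inner_eq, heisenbergData_J, mk_x, mk_y, mk_s, mk_t, zero_mul, add_zero]
  exact Finset.sum_congr rfl fun j _ => by ring

/-- Translation by `p⁻¹` rotates both arguments by the same angles: the planar inner products are
unchanged, and so is the area form in the `ξ`-component. Equality of the `λ_j` plays no role here.
-/
theorem metric_eq (n : ℕ) (lam : Fin n → ℝ) : metric n lam = (heisenbergData n lam).metric := by
  funext p
  ext X Y
  have h : metric n lam p X Y =
      ⟪fderiv ℝ (fun q => p⁻¹ * q) p X, fderiv ℝ (fun q => p⁻¹ * q) p Y⟫_ℝ := rfl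
  have hs : ∀ Z : OscillatorGroup n lam,
      ∑ j, (p⁻¹.x j * rotY p⁻¹.t Z j - p⁻¹.y j * rotX p⁻¹.t Z j) =
        -∑ j, (p.x j * Z.y j - p.y j * Z.x j) := fun Z => by
    rw [← Finset.sum_neg_distrib]
    refine Finset.sum_congr rfl fun j _ => ?_
    simp only [inv_x, inv_y, inv_t, rotX, rotY]
    linear_combination (-(p.x j * Z.y j - p.y j * Z.x j)) * Real.sin_sq_add_cos_sq (lam j * -p.t)
  rw [h, HeisenbergData.metric_apply, fderiv_mul_left, fderiv_mul_left, hs, hs]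
  simp only [HeisenbergData.coframe_apply, inner_heisenbergData_J, heisenbergData_ξ]
  simp only [inner_eq, mk_x, mk_y, mk_s, mk_t, sub_x, sub_y, sub_s, sub_t, smul_x, smul_y, smul_s, smul_t,
    Pi.zero_apply, mul_zero, sub_zero, mul_one]
  have hxy : ∑ j, (rotX p⁻¹.t X j * rotX p⁻¹.t Y j + rotY p⁻¹.t X j * rotY p⁻¹.t Y j) =
      ∑ j, (X.x j * Y.x j + X.y j * Y.y j) := by
    refine Finset.sum_congr rfl fun j _ => ?_
    simp only [rotX, rotY]
    linear_combination (X.x j * Y.x j + X.y j * Y.y j) *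
      Real.sin_sq_add_cos_sq (lam j * p⁻¹.t)
  rw [hxy]
  ring

/-- Left translation turns the `j`-th plane component of `V 1` by `λ_j t` and adds the Heisenberg
term along `ξ`, which is the effect of `frame`. With equal `λ_j` all planes turn together, as in
`rotate`. -/
theorem IsLeftInvariant.eq_field {V : OscillatorGroup n lam → OscillatorGroup n lam}
    (hV : IsLeftInvariant V) {l : ℝ} (hl : ∀ j, lam j = l) :
    V = (heisenbergData n lam).field ((heisenbergData n lam).rotate l (V 1)) := by
  funext p
  have h := hV p 1
  rw [mul_one, fderiv_mul_left] at h
  have hζ : ∀ q : OscillatorGroup n lam, ⟪(mk 0 0 0 1 : OscillatorGroup n lam), q⟫_ℝ = q.t :=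
    fun q => by simp [inner_eq]
  have hξ : ∀ q : OscillatorGroup n lam, ⟪(mk 0 0 1 0 : OscillatorGroup n lam), q⟫_ℝ = q.s :=
    fun q => by simp [inner_eq]
  have hR : (heisenbergData n lam).rotate l (V 1) p =
      mk (rotX p.t (V 1)) (rotY p.t (V 1)) (V 1).s (V 1).t := by
    ext j <;> simp [HeisenbergData.rotate, HeisenbergData.hor, heisenbergData_J, heisenbergData_ξ,
      heisenbergData_ζ, hξ, hζ, rotX, rotY, hl]
    · ring
    · ring
  rw [← h, HeisenbergData.field, HeisenbergData.frame_apply, hR, inner_heisenbergData_J,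
    heisenbergData_ξ]
  ext j <;> simp

end OscillatorGroup

end

theorem corollary3 (n : ℕ) (lam : Fin n → ℝ) (hlam : ∀ i j, lam i = lam j)
    (V : OscillatorGroup n lam → OscillatorGroup n lam)
    (hV : OscillatorGroup.IsLeftInvariant V)
    (hharm : Riem.DefinesHarmonicMap (OscillatorGroup.metric n lam) V) :
    Riem.IsMinimalField (OscillatorGroup.metric n lam) V := by
  obtain ⟨l, hl⟩ : ∃ l, ∀ j, lam j = l := by
    rcases isEmpty_or_nonempty (Fin n) with h | ⟨⟨i⟩⟩
    -- For `n = 0` there is no `λ_j`, and any speed serves.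
    · exact ⟨0, fun j => h.elim j⟩
    · exact ⟨lam i, fun j => hlam j i⟩
  rw [OscillatorGroup.metric_eq] at hharm ⊢
  rw [hV.eq_field hl] at hharm ⊢
  exact (HeisenbergData.isRotating_rotate _ l (V 1)).isMinimalField hharm
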